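/- Let $n\ge 1$, $k\ge 0$ with $2k+1\le n$. In type $C_n$ identify the weight lattice with $\mathbb Z^n$ (standard basis $e_1,\dots,e_n$), with positive roots $e_i\pm e_j$ ($i<j$) and $2e_i$, Weyl group $W$ (signed permutations), length function $l$, $\rho=\sum_j (n-j+1)e_j$, highest root $\theta=2e_1$, $\theta^\vee=e_1$, and $\omega_m=e_1+\dots+e_m$ (with $\omega_0=0$). Let $q,t$ be indeterminates. Consider the free $\mathbb C(q,t)$-module with basis the symbols $C_\lambda$, $\lambda$ a dominant weight, and for an arbitrary weight $\mu$ put $C_\mu=0$ if $\mu+\rho$ is not regular and $C_\mu=(-1)^{l(\sigma)}C_\lambda$ if $\sigma(\mu+\rho)=\lambda+\rho$ with $\sigma\in W$ and $\lambda$ dominant. For a root $\beta=2e_j$ define $f_i^\beta$ by $$(1-tz)(1-qtz)\frac{(t^2z)^{(\rho,\beta^\vee)}-1}{t^2z-1}=\sum_{i\ge 0}t^{(\rho,\beta^\vee)}f_i^\beta(q,t)z^i ,\qquad (\rho,\beta^\vee)=n-j+1 .$$ For $\lambda_k=\omega_1+\omega_{2k+1}$ the reduced quasi-minuscule recurrence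 $R_k$ (for the given $n$) is the linear form (whose vanishing is the recurrence) $$R_k=\sum_{(\mu,\beta)}\sum_{i\ge 0}\left[f_i^\beta(q,t)-q^{2}f_i^\beta(q^{-1},t^{-1})\right]C_{\mu-i\beta},$$ where $(\mu,\beta)$ runs over the set $\{(w\lambda_k,w\theta): w\in W,\ w\theta>0\}$. Write $C_{2|k}=C_{\omega_1+\omega_{2k+1}}$, $C_{k}=C_{\omega_{2k}}$, and let $\Lambda_{2|k}^{2|k,n}$ be the coefficient of $C_{2|k}$ in $R_k$. Then there are integers $B_i^{k,n}$ ($0\le i\le k$) with $B_k^{k,n}=1$ and $$\sum_{i=h}^k(-1)^{i-h}\binom{n-i-h-1}{i-h}B_i^{k,n}=0\qquad(0\le h<k),$$ and coefficients $\Gamma_i^{k,n}\in\mathbb C(q,t)$, such that, if $n=2k+1$, $$\sum_{i=0}^k B_i^{k,n}R_i=\Lambda_{2|k}^{2|k,n}C_{2|k}+\Gamma_k^{k,n}C_k+\Gamma_0^{k,n}\left(C_{k-1}+\dots+C_0\right),$$ and, if $n>2k+1$, $$\sum_{i=0}^k B_i^{k,n}R_i=\Lambda_{2|k}^{2|k,n}C_{2|k}+\Gamma_{k+1}^{k,n}C_{k+1}+\Gamma_k^{k,n}C_k+\Gamma_0^{k,n}\left(C_{k-1}+\dots+C_0\right),$$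 as identities of linear forms. Moreover, if $k\ge 1$, $$\Gamma_0^{k,n}=\frac{(t^2+q)(t-q)(t^{2(n-2k)}-1)}{t^{n-2k+1}(t-1)} .$$ -/

import Mathlib

namespace TypeC

open Finset Polynomial

/-! ### Root data of type `C_n`

Weights are vectors of `ℤ^n`, written in the orthonormal basis `e_1, ..., e_n`; the coordinate with
number `j + 1` of `v` is `v j`, `j : Fin n`. -/

/-- The weight lattice of type `C_n`. -/
abbrev Weight (n : ℕ) : Type := Fin n → ℤ

/-- The basis vector `e_{i+1}`. -/
def e {n : ℕ} (i : Fin n) : Weight n := Pi.single i 1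

/-- The positive roots: `e_i - e_j`, `e_i + e_j` for `i < j`, and `2 e_i`. -/
def posRoots (n : ℕ) : Finset (Weight n) :=
  Finset.image (fun p : Fin n × Fin n => e p.1 - e p.2) {p | p.1 < p.2} ∪
    Finset.image (fun p : Fin n × Fin n => e p.1 + e p.2) {p | p.1 < p.2} ∪
    Finset.image (fun i : Fin n => (2 : ℤ) • e i) univ

/-- The Weyl vector `ρ = ∑_j (n - j + 1) e_j`. -/
def rho (n : ℕ) : Weight n := fun j => (n : ℤ) - (j : ℤ)

/-- The fundamental weight `ω_m = e_1 + ... + e_m` (with `ω_0 = 0`). -/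
def omega (n m : ℕ) : Weight n := fun j => if (j : ℕ) < m then 1 else 0

/-- The highest root `θ = 2 e_1 = 2 ω_1`. -/
def theta (n : ℕ) : Weight n := (2 : ℤ) • omega n 1

/-- The pairing `(v, β^∨) = 2 (v, β) / (β, β)` of a weight with the coroot of a root `β`
(the division is exact for every root `β`). -/
def corootPairing {n : ℕ} (v β : Weight n) : ℤ := 2 * (v ⬝ᵥ β) / (β ⬝ᵥ β)

/-- Dominant weights. -/
def IsDominant {n : ℕ} (v : Weight n) : Prop := ∀ α ∈ posRoots n, 0 ≤ v ⬝ᵥ α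

/-- Regular weights: those orthogonal to no root. -/
def IsRegular {n : ℕ} (v : Weight n) : Prop := ∀ α ∈ posRoots n, v ⬝ᵥ α ≠ 0

/-! ### The Weyl group -/

/-- The Weyl group of type `C_n`: the signed permutations, given by a permutation `w.1` of the
coordinates and signs `w.2`. -/
abbrev Weyl (n : ℕ) : Type := Equiv.Perm (Fin n) × (Fin n → ℤˣ)

/-- The action of a signed permutation: `e_i ↦ ± e_{w i}`, the sign being that at `w i`. -/
def act {n : ℕ} (w : Weyl n) (v : Weight n) : Weight n := fun j => (w.2 j : ℤ) * v (w.1.symm j)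

/-- The length `l(w)`: the number of positive roots that `w` makes negative. -/
def length {n : ℕ} (w : Weyl n) : ℕ := #{α ∈ posRoots n | -(act w α) ∈ posRoots n}

/-! ### Formal linear combinations of the `C_μ` -/

/-- The field `ℂ(q, t)` of rational functions. -/
abbrev RatQT : Type := FractionRing (MvPolynomial (Fin 2) ℂ)

/-- The indeterminate `q`. -/
noncomputable def q : RatQT := algebraMap (MvPolynomial (Fin 2) ℂ) RatQT (MvPolynomial.X 0)

/-- The indeterminate `t`. -/
noncomputable def t : RatQT := algebraMap (MvPolynomial (Fin 2) ℂ) RatQT (MvPolynomial.X 1)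

/-- Linear forms over `ℂ(q, t)` in independent symbols, one for each weight
(only dominant ones will occur). -/
abbrev LinForm (n : ℕ) : Type := Weight n →₀ RatQT

open Classical in
/-- The symbol `C_μ` in its reduced form: `0` if `μ + ρ` is not regular, and
`(-1)^{l(σ)} C_λ` if `σ (μ + ρ) = λ + ρ` with `λ` dominant, `C_λ` being the basis vector at `λ`.
The sum below has one nonzero term in the second case and none in the first one;
see `C_of_not_isRegular` and `C_of_act_eq`. -/
noncomputable def C {n : ℕ} (μ : Weight n) : LinForm n :=
  ∑ σ : Weyl n, if IsDominant (act σ (μ + rho n) - rho n) then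
    ((-1 : RatQT) ^ length σ) • Finsupp.single (act σ (μ + rho n) - rho n) 1 else 0

/-! ### The quasi-minuscule recurrence -/

/-- The polynomial `(1 - b z) (1 - a b z) ((b² z)^m - 1) / (b² z - 1)` in `z`; the quotient is
written as a geometric sum, see `genPoly_mul`. -/
noncomputable def genPoly {F : Type} [Field F] (a b : F) (m : ℕ) : F[X] :=
  (1 - Polynomial.C b * X) * (1 - Polynomial.C (a * b) * X) *
    ∑ s ∈ range m, (Polynomial.C (b ^ 2) * X) ^ s

/-- The numbers `f_i(a, b)` with `genPoly a b m = ∑_i b^m f_i(a, b) z^i`;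
here `m` stands for `(ρ, β^∨)`. -/
noncomputable def f {F : Type} [Field F] (a b : F) (m i : ℕ) : F :=
  (b ^ m)⁻¹ * (genPoly a b m).coeff i

/-- The pairs `(w λ, w θ)`, `w ∈ W`, with `w θ` positive (a set of pairs, without repetition). -/
def pairs {n : ℕ} (lam : Weight n) : Finset (Weight n × Weight n) :=
  {p ∈ univ.image fun w : Weyl n => (act w lam, act w (theta n)) | p.2 ∈ posRoots n}

/-- The left-hand side of the quasi-minuscule recurrence for `λ`, in reduced form:
`∑_{(μ, β)} ∑_{i ≥ 0} [f_i^β(q, t) - q^{(λ, θ^∨)} f_i^β(q⁻¹, t⁻¹)] C_{μ - i β}`.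
The sum over `i` stops at `(ρ, β^∨) + 1`, since all later `f_i^β` vanish; see `f_eq_zero`. -/
noncomputable def recurrence {n : ℕ} (lam : Weight n) : LinForm n :=
  ∑ p ∈ pairs lam, ∑ i ∈ range ((corootPairing (rho n) p.2).toNat + 2),
    (f q t (corootPairing (rho n) p.2).toNat i -
        q ^ corootPairing lam (theta n) * f q⁻¹ t⁻¹ (corootPairing (rho n) p.2).toNat i) •
      C (p.1 - (i : ℤ) • p.2)

/-- The weight `ω_1 + ω_{2k+1}`. -/
def lam (n k : ℕ) : Weight n := omega n 1 + omega n (2 * k + 1)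

/-- The reduced recurrence `R_k` for `ω_1 + ω_{2k+1}` in type `C_n`. -/
noncomputable def R (n k : ℕ) : LinForm n := recurrence (lam n k)

/-- The symbol `C_{2|k}` in type `C_n`, attached to `ω_1 + ω_{2k+1}`. -/
noncomputable def Ctwo (n k : ℕ) : LinForm n := C (lam n k)

/-- The symbol `C_k` in type `C_n`, attached to `ω_{2k}`. -/
noncomputable def Cone (n k : ℕ) : LinForm n := C (omega n (2 * k))

/-- The coefficient of `C_{2|k}` in the reduced recurrence `R_k`. -/
noncomputable def LambdaTwo (n k : ℕ) : RatQT := R n k (lam n k)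

/-! ### The definitions agree with their descriptions -/

theorem genPoly_mul {F : Type} [Field F] (a b : F) (m : ℕ) :
    genPoly a b m * (Polynomial.C (b ^ 2) * X - 1) =
      (1 - Polynomial.C b * X) * (1 - Polynomial.C (a * b) * X) *
        ((Polynomial.C (b ^ 2) * X) ^ m - 1) := by
  rw [genPoly, mul_assoc, geom_sum_mul]

theorem f_eq_zero {F : Type} [Field F] (a b : F) (m i : ℕ) (h : m + 2 ≤ i) : f a b m i = 0 := by
  have h1 : ∀ c : F, (1 - Polynomial.C c * X : F[X]).natDegree ≤ 1 := fun c => by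
    refine (natDegree_sub_le _ _).trans ?_
    simpa using (natDegree_C_mul_le c X).trans natDegree_X_le
  rcases Nat.eq_zero_or_pos m with rfl | hm
  · simp [f, genPoly]
  have h2 : (∑ s ∈ range m, (Polynomial.C (b ^ 2) * X) ^ s : F[X]).natDegree ≤ m - 1 := by
    refine natDegree_sum_le_of_forall_le _ _ fun s hs => ?_
    have : (Polynomial.C (b ^ 2) * X : F[X]).natDegree ≤ 1 :=
      (natDegree_C_mul_le _ X).trans natDegree_X_le
    refine (natDegree_pow_le_of_le s this).trans ?_
    have := Finset.mem_range.1 hs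
    omega
  have h3 : (genPoly a b m).natDegree ≤ 1 + 1 + (m - 1) :=
    natDegree_mul_le_of_le (natDegree_mul_le_of_le (h1 b) (h1 (a * b))) h2
  rw [f, coeff_eq_zero_of_natDegree_lt (by omega), mul_zero]

theorem dotProduct_e {n : ℕ} (v : Weight n) (i : Fin n) : v ⬝ᵥ e i = v i := by
  simp [e]

theorem posRoots_pair {n : ℕ} (i j : Fin n) (h : i < j) :
    e i - e j ∈ posRoots n ∧ e i + e j ∈ posRoots n := by
  simp only [posRoots, mem_union, mem_image, mem_filter, mem_univ, true_and, Prod.exists]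
  exact ⟨Or.inl (Or.inl ⟨i, j, h, rfl⟩), Or.inl (Or.inr ⟨i, j, h, rfl⟩)⟩

theorem posRoots_long {n : ℕ} (i : Fin n) : (2 : ℤ) • e i ∈ posRoots n := by
  simp only [posRoots, mem_union, mem_image, mem_univ, true_and]
  exact Or.inr ⟨i, rfl⟩

/-- `λ + ρ` has strictly decreasing positive coordinates if `λ` is dominant. -/
theorem IsDominant.add_rho {n : ℕ} {v : Weight n} (h : IsDominant v) :
    StrictAnti (v + rho n) ∧ ∀ j, 0 < (v + rho n) j := by
  constructor
  · intro i j hij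
    have := h _ (posRoots_pair i j hij).1
    rw [dotProduct_sub, dotProduct_e, dotProduct_e] at this
    have h' : (i : ℤ) < j := by exact_mod_cast hij
    simp only [Pi.add_apply, rho]
    omega
  · intro j
    have := h _ (posRoots_long j)
    rw [dotProduct_smul, dotProduct_e, smul_eq_mul] at this
    have h' : (j : ℤ) < n := by exact_mod_cast j.2
    simp only [Pi.add_apply, rho]
    omega

theorem abs_act {n : ℕ} (w : Weyl n) (v : Weight n) (j : Fin n) :
    |act w v j| = |v (w.1.symm j)| := by
  rcases Int.units_eq_one_or (w.2 j) with h | h <;> simp [act, h]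

/-- Two signed permutations taking `v` to strictly decreasing positive vectors coincide. -/
theorem weyl_unique {n : ℕ} {v : Weight n} {σ τ : Weyl n}
    (hσ : StrictAnti (act σ v)) (hσ' : ∀ j, 0 < act σ v j)
    (hτ : StrictAnti (act τ v)) (hτ' : ∀ j, 0 < act τ v j) : σ = τ := by
  have key : ∀ j, act σ v j = act τ v (τ.1 (σ.1.symm j)) := fun j => by
    rw [← abs_of_pos (hσ' j), ← abs_of_pos (hτ' _), abs_act, abs_act, Equiv.symm_apply_apply]
  have hp : σ.1.symm.trans τ.1 = Equiv.refl _ := by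
    let o : Fin n ≃o Fin n := StrictMono.orderIsoOfSurjective
      (σ.1.symm.trans τ.1) (fun i j hij => by
        have := hσ hij
        rw [key i, key j] at this
        exact hτ.lt_iff_gt.1 this) (σ.1.symm.trans τ.1).surjective
    have ho : o = OrderIso.refl _ := Subsingleton.elim _ _
    ext j
    exact congrArg Fin.val (congrArg (fun g : Fin n ≃o Fin n => g j) ho)
  have h1 : σ.1 = τ.1 := by
    ext i
    have := congrArg (fun g : Equiv.Perm (Fin n) => g (σ.1 i)) hp
    simp only [Equiv.trans_apply, Equiv.symm_apply_apply, Equiv.refl_apply] at this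
    rw [this]
  refine Prod.ext h1 (funext fun j => ?_)
  have a := hσ' j
  have b := hτ' j
  rw [act] at a b
  rw [h1] at a
  rcases Int.units_eq_one_or (σ.2 j) with h | h <;>
    rcases Int.units_eq_one_or (τ.2 j) with h' | h' <;> rw [h] at a ⊢ <;> rw [h'] at b ⊢ <;>
    simp at a b <;> omega

theorem C_of_act_eq {n : ℕ} {μ ν : Weight n} (σ : Weyl n) (hν : IsDominant ν)
    (h : act σ (μ + rho n) = ν + rho n) :
    C μ = ((-1 : RatQT) ^ length σ) • Finsupp.single ν 1 := by
  classical
  rw [C, Finset.sum_eq_single σ]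
  · rw [h, add_sub_cancel_right, if_pos hν]
  · intro τ _ hne
    refine if_neg fun hd => hne ?_
    have h1 := hd.add_rho
    have h2 := hν.add_rho
    rw [sub_add_cancel] at h1
    rw [← h] at h2
    exact weyl_unique h1.1 h1.2 h2.1 h2.2
  · simp

theorem C_of_isDominant {n : ℕ} {ν : Weight n} (hν : IsDominant ν) :
    C ν = Finsupp.single ν 1 := by
  have h1 : ∀ v : Weight n, act (1 : Weyl n) v = v := fun v => by
    ext j
    simp only [act, Prod.fst_one, Prod.snd_one, Pi.one_apply, Units.val_one, one_mul]
    rfl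
  have h2 : length (1 : Weyl n) = 0 := by
    rw [length, Finset.card_eq_zero, Finset.filter_eq_empty_iff]
    intro α hα hα'
    rw [h1] at hα'
    have h0 : IsDominant (0 : Weight n) := fun β _ => by simp
    have hr : ∀ β ∈ posRoots n, 0 < rho n ⬝ᵥ β := by
      have h3 := h0.add_rho
      rw [zero_add] at h3
      intro β hβ
      simp only [posRoots, mem_union, mem_image, mem_filter, mem_univ, true_and,
        Prod.exists] at hβ
      rcases hβ with (⟨i, j, hij, rfl⟩ | ⟨i, j, hij, rfl⟩) | ⟨i, rfl⟩
      · rw [dotProduct_sub, dotProduct_e, dotProduct_e]; have := h3.1 hij; omega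
      · rw [dotProduct_add, dotProduct_e, dotProduct_e]
        have := h3.2 i; have := h3.2 j; omega
      · rw [dotProduct_smul, dotProduct_e, smul_eq_mul]; have := h3.2 i; omega
    have a := hr _ hα
    have b := hr _ hα'
    rw [dotProduct_neg] at b
    omega
  rw [C_of_act_eq 1 hν (h1 _), h2, pow_zero, one_smul]

theorem C_of_not_isRegular {n : ℕ} {μ : Weight n} (h : ¬ IsRegular (μ + rho n)) : C μ = 0 := by
  classical
  rw [C]
  refine Finset.sum_eq_zero fun σ _ => if_neg fun hd => h ?_
  have h1 := hd.add_rho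
  rw [sub_add_cancel] at h1
  generalize μ + rho n = v at h1
  have hz : ∀ i, v i ≠ 0 := fun i hi => by
    have := abs_act σ v (σ.1 i)
    rw [Equiv.symm_apply_apply, hi, abs_of_pos (h1.2 _), abs_zero] at this
    exact (h1.2 (σ.1 i)).ne' this
  have hne : ∀ i j, i ≠ j → |v i| ≠ |v j| := fun i j hij hv => by
    have a := abs_act σ v (σ.1 i)
    have b := abs_act σ v (σ.1 j)
    rw [Equiv.symm_apply_apply, abs_of_pos (h1.2 _)] at a b
    exact hij (σ.1.injective (h1.1.injective (a.trans (hv.trans b.symm))))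
  intro β hβ
  simp only [posRoots, mem_union, mem_image, mem_filter, mem_univ, true_and, Prod.exists] at hβ
  rcases hβ with (⟨i, j, hij, rfl⟩ | ⟨i, j, hij, rfl⟩) | ⟨i, rfl⟩
  · rw [dotProduct_sub, dotProduct_e, dotProduct_e]
    intro h0
    exact hne i j hij.ne (by rw [sub_eq_zero.1 h0])
  · rw [dotProduct_add, dotProduct_e, dotProduct_e]
    intro h0
    exact hne i j hij.ne (by rw [eq_neg_of_add_eq_zero_left h0, abs_neg])
  · rw [dotProduct_smul, dotProduct_e, smul_eq_mul]
    have := hz i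
    omega

end TypeC

/-! For dominant `ν`, the coefficient of `C_ν` in `C_μ` is the signed count of Weyl group elements
carrying `μ + ρ` to `ν + ρ`, that is, a determinant of odd delta functions of their coordinates
(`C_apply`). In the pairs of `R_i`, `μ` has one entry `2` at the place of the long root, `2i`
entries `±1`, and zeros elsewhere. By multilinearity, the coefficients at `ν` of `R_0, R_1, ...` are
the even coefficients of a single polynomial `detSum` (`R_apply_eq_coeff`): row `m` of the matrix is
`δ_m + X (δ_{m+1} + δ_{m-1})`, each row in turn is replaced by `diffRow`, and the results are added.
Only the columns depend on `ν`.

On the columns `1, ..., n` the unmodified matrix is `1 + X T`, with `T` the adjacency matrix of a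
path. Its determinant is `P_{n+1}` (`pathPoly`), and its cofactors are signed powers of `X` times
products of two path polynomials. With the closed form `diffRow_eq` and the edge-cutting identity
`pathPoly_mul_succ`, the sum for `ν = 0` becomes `c P_n + ∑_{h ≥ 1} s(n - 2h) X^{2h} P_{n-2h}`,
where `s` is `stableCoeff` (`skipSum_add_two_eq`, `stablePart_add_two`). For `ω_p` the column `n + 1
- p` is missing; the result is `X^p` times the sum of rank `n - p`, up to multiples of `X^p P_{n-p}`
and `X^{p-2} P_{n-p+1}` (`skipSum_gap`). For `ω_1 + ω_{p+1}` it is a constant times `X^p P_{n-p}`,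
and for all other dominant weights it is `0`.

The equations for `B` say that the functional `L`, taking a polynomial to the sum of `B_i` times its
coefficient at `X^{2i}`, sends `X^{2h} P_{n-2h}` to `1` if `h = k` and to `0` otherwise
(`evenFunctional_even`); by parity `L` kills `X^{2i+1} P_p`. At `ω_{2j}` with `j < k` exactly the
term `s(n - 2k)` survives, whence the common coefficient `Γ_0`; for `j > k + 1` nothing survives.
The unknown constants matter only at `j = k` and `j = k + 1`. -/

namespace TypeC

open Finset Polynomial

/-! ### Path polynomials -/

section PathPoly

variable {F : Type} [Field F]

/-- The determinant of `1 + X T`, where `T` is the adjacency matrix of the path with `p - 1`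
vertices; it vanishes by convention for `p = 0`. -/
noncomputable def pathPoly (F : Type) [Field F] : ℕ → F[X]
  | 0 => 0
  | 1 => 1
  | p + 2 => pathPoly F (p + 1) - X ^ 2 * pathPoly F p

theorem pathPoly_add_two (p : ℕ) :
    pathPoly F (p + 2) = pathPoly F (p + 1) - X ^ 2 * pathPoly F p := by
  rw [pathPoly]

@[simp] theorem pathPoly_zero : pathPoly F 0 = 0 := rfl

@[simp] theorem pathPoly_one : pathPoly F 1 = 1 := rfl

@[simp] theorem pathPoly_two : pathPoly F 2 = 1 := by simp [pathPoly_add_two]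

/-- Cut one edge of a path with `i + j` vertices: the edge accounts for `-X ^ 2` times the
determinants of what remains once both its ends are removed. All later resummations rest on this
identity. -/
theorem pathPoly_mul_succ (i j : ℕ) :
    pathPoly F (i + 1) * pathPoly F (j + 1) =
      pathPoly F (i + j + 1) + X ^ 2 * (pathPoly F i * pathPoly F j) := by
  induction i using Nat.twoStepInduction with
  | zero => simp
  | one =>
    rw [show 1 + j + 1 = j + 2 by ring, pathPoly_add_two j]
    simp
  | more i h1 h2 =>
    rw [show i + 2 + j + 1 = (i + j + 1) + 2 by ring, pathPoly_add_two (i + j + 1),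
      show i + 2 + 1 = (i + 1) + 2 by ring, pathPoly_add_two (i + 1), pathPoly_add_two i]
    rw [show i + 1 + j + 1 = i + j + 1 + 1 by ring] at h2
    rw [pathPoly_add_two i] at h2
    linear_combination h2 - X ^ 2 * h1

theorem coeff_zero_pathPoly (p : ℕ) : (pathPoly F (p + 1)).coeff 0 = 1 := by
  induction p with
  | zero => simp
  | succ p h => simp [pathPoly_add_two, h, mul_coeff_zero]

theorem pathPoly_ne_zero (p : ℕ) : pathPoly F (p + 1) ≠ 0 := fun h => by
  simpa [h] using coeff_zero_pathPoly (F := F) p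

theorem coeff_pathPoly_odd (p s : ℕ) : (pathPoly F p).coeff (2 * s + 1) = 0 := by
  induction p using Nat.twoStepInduction generalizing s with
  | zero => simp
  | one => simp [coeff_one]
  | more p h1 h2 =>
    rw [pathPoly_add_two, coeff_sub, h2, zero_sub, neg_eq_zero, coeff_X_pow_mul']
    split_ifs with h
    · obtain ⟨s, rfl⟩ : ∃ s', s = s' + 1 := ⟨s - 1, by omega⟩
      exact h1 s
    · rfl

/-- The binomial counts the matchings with `s` edges in a path with `p` vertices. These numbers are
the source of the binomials in the system for `B`. -/
theorem coeff_pathPoly_even (p s : ℕ) :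
    (pathPoly F (p + 1)).coeff (2 * s) = (-1) ^ s * ((p - s).choose s : F) := by
  induction p using Nat.twoStepInduction generalizing s with
  | zero => cases s <;> simp [coeff_one]
  | one =>
    rcases s with _ | _ | s <;> simp [coeff_one]
  | more p h1 h2 =>
    rcases s with _ | s
    · rw [mul_zero, coeff_zero_pathPoly]; simp
    · rw [show p + 2 + 1 = p + 1 + 2 by ring, pathPoly_add_two, coeff_sub, h2,
        show 2 * (s + 1) = 2 * s + 2 by ring, coeff_X_pow_mul,
        h1, show p + 1 - (s + 1) = p - s by omega]
      rcases Nat.lt_or_ge p s with h | h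
      · rw [show p - s = 0 by omega, show p + 2 - (s + 1) = 0 by omega]
        rcases s with _ | s
        · omega
        · simp
      · rw [show p + 2 - (s + 1) = (p - s) + 1 by omega, Nat.choose_succ_succ]
        push_cast
        ring

end PathPoly

/-! ### Triangular systems -/

/-- A unitriangular linear system has a solution with prescribed last coordinate. -/
theorem exists_triangular_solution (M : ℕ → ℕ → ℤ) (hM : ∀ h, M h h = 1) (k : ℕ) :
    ∃ B : ℕ → ℤ, B k = 1 ∧ ∀ h < k, ∑ i ∈ Icc h k, M h i * B i = 0 := by
  have key : ∀ d ≤ k, ∃ B : ℕ → ℤ, B k = 1 ∧ ∀ h < k, k ≤ h + d →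
      ∑ i ∈ Icc h k, M h i * B i = 0 := by
    intro d
    induction d with
    | zero => exact fun _ => ⟨fun _ => 1, rfl, fun h h1 h2 => by omega⟩
    | succ d ih =>
      intro hd
      obtain ⟨B, hB, hB'⟩ := ih (by omega)
      -- Backward substitution: the equations already solved involve only indices above `h0`, so
      -- changing `B h0` leaves them intact.
      set h0 := k - (d + 1) with hh0
      refine ⟨Function.update B h0 (-∑ i ∈ Ioc h0 k, M h0 i * B i), ?_, fun h h1 h2 => ?_⟩
      · rw [Function.update_of_ne (by omega), hB]
      · rcases eq_or_ne h h0 with rfl | hne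
        · rw [← Finset.Ioc_insert_left h1.le, sum_insert (by simp), Function.update_self, hM]
          rw [one_mul, neg_add_eq_zero]
          refine sum_congr rfl fun i hi => ?_
          rw [Function.update_of_ne (by have := mem_Ioc.1 hi; omega)]
        · rw [← hB' h h1 (by omega)]
          refine sum_congr rfl fun i hi => ?_
          rw [Function.update_of_ne (by have := mem_Icc.1 hi; omega)]
  obtain ⟨B, hB, hB'⟩ := key k le_rfl
  exact ⟨B, hB, fun h h1 => hB' h h1 (by omega)⟩

/-! ### Signs of Weyl group elements -/

section Sign

variable {n : ℕ}

theorem act_e (w : Weyl n) (i : Fin n) : act w (e i) = (w.2 (w.1 i) : ℤ) • e (w.1 i) := by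
  ext j
  simp only [act, e, Pi.smul_apply, smul_eq_mul, Pi.single_apply]
  by_cases h : j = w.1 i
  · simp [h]
  · rw [if_neg h, if_neg (fun h' => h (by rw [← h', Equiv.apply_symm_apply])), mul_zero, mul_zero]

theorem act_add (w : Weyl n) (v v' : Weight n) : act w (v + v') = act w v + act w v' := by
  ext j; simp [act, mul_add]

theorem act_smul (w : Weyl n) (c : ℤ) (v : Weight n) : act w (c • v) = c • act w v := by
  ext j; simp [act, mul_left_comm]

theorem act_sub (w : Weyl n) (v v' : Weight n) : act w (v - v') = act w v - act w v' := by
  ext j; simp [act, mul_sub]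

theorem act_dotProduct_act (w : Weyl n) (v v' : Weight n) : act w v ⬝ᵥ act w v' = v ⬝ᵥ v' := by
  simp only [dotProduct, act]
  rw [← Equiv.sum_comp w.1.symm (fun i => v i * v' i)]
  refine sum_congr rfl fun i _ => ?_
  rcases Int.units_eq_one_or (w.2 i) with h | h <;> simp [h]

theorem act_injective (w : Weyl n) : Function.Injective (act w) := by
  intro v v' h
  ext j
  have := congrFun h (w.1 j)
  simp only [act, Equiv.symm_apply_apply] at this
  rcases Int.units_eq_one_or (w.2 (w.1 j)) with h | h <;> simpa [h] using this

theorem rho_dotProduct_pos {α : Weight n} (h : α ∈ posRoots n) : 0 < rho n ⬝ᵥ α := by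
  have h0 : IsDominant (0 : Weight n) := fun β _ => by simp
  have h3 := h0.add_rho
  rw [zero_add] at h3
  simp only [posRoots, mem_union, mem_image, mem_filter, mem_univ, true_and, Prod.exists] at h
  rcases h with (⟨i, j, hij, rfl⟩ | ⟨i, j, hij, rfl⟩) | ⟨i, rfl⟩
  · rw [dotProduct_sub, dotProduct_e, dotProduct_e]; have := h3.1 hij; omega
  · rw [dotProduct_add, dotProduct_e, dotProduct_e]
    have := h3.2 i; have := h3.2 j; omega
  · rw [dotProduct_smul, dotProduct_e, smul_eq_mul]; have := h3.2 i; omega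

theorem neg_notMem_posRoots {α : Weight n} (h : α ∈ posRoots n) : -α ∉ posRoots n := fun h' => by
  have a := rho_dotProduct_pos h
  have b := rho_dotProduct_pos h'
  rw [dotProduct_neg] at b
  omega

theorem units_smul_add_mem {i j : Fin n} (h : i ≠ j) (a b : ℤˣ) :
    (a : ℤ) • e i + (b : ℤ) • e j ∈ posRoots n ∨
      -((a : ℤ) • e i + (b : ℤ) • e j) ∈ posRoots n := by
  wlog hij : i < j generalizing i j a b
  · rw [add_comm]
    exact this h.symm b a (lt_of_le_of_ne (not_lt.1 hij) h.symm)
  have := posRoots_pair i j hij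
  rcases Int.units_eq_one_or a with rfl | rfl <;> rcases Int.units_eq_one_or b with rfl | rfl
  · left; simpa using this.2
  · left; simpa [sub_eq_add_neg] using this.1
  · right; simpa [sub_eq_add_neg, add_comm] using this.1
  · right; simpa [add_comm] using this.2

theorem act_mem_posRoots_or (w : Weyl n) {α : Weight n} (h : α ∈ posRoots n) :
    act w α ∈ posRoots n ∨ -act w α ∈ posRoots n := by
  simp only [posRoots, mem_union, mem_image, mem_filter, mem_univ, true_and, Prod.exists] at h
  rcases h with (⟨i, j, hij, rfl⟩ | ⟨i, j, hij, rfl⟩) | ⟨i, rfl⟩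
  · have := units_smul_add_mem (w.1.injective.ne hij.ne) (w.2 (w.1 i)) (-w.2 (w.1 j))
    rw [act_sub, act_e, act_e]
    simpa only [Units.val_neg, neg_smul, ← sub_eq_add_neg] using this
  · have := units_smul_add_mem (w.1.injective.ne hij.ne) (w.2 (w.1 i)) (w.2 (w.1 j))
    simpa only [act_add, act_e] using this
  · have := posRoots_long (w.1 i)
    rw [act_smul, act_e]
    rcases Int.units_eq_one_or (w.2 (w.1 i)) with h | h
    · left; simpa [h] using this
    · right; simpa [h] using this

/-- Up to signs `w` permutes the positive roots, by the map `g` below, and the number of sign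
changes is the length. -/
theorem prod_posRoots_act (w : Weyl n) (v : Weight n) :
    ∏ α ∈ posRoots n, act w v ⬝ᵥ α = (-1) ^ length w * ∏ α ∈ posRoots n, v ⬝ᵥ α := by
  classical
  let g : Weight n → Weight n := fun α => if -act w α ∈ posRoots n then -act w α else act w α
  have hg : ∀ α ∈ posRoots n, g α ∈ posRoots n := fun α hα => by
    dsimp only [g]
    split_ifs with h
    · exact h
    · exact (act_mem_posRoots_or w hα).resolve_right h
  have hneg : ∀ α : Weight n, -act w α = act w (-α) := fun α => by
    rw [← neg_one_smul ℤ α, act_smul, neg_one_smul]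
  have hinj : Set.InjOn g (posRoots n) := by
    intro α hα β hβ h
    dsimp only [g] at h
    rw [hneg, hneg] at h
    split_ifs at h
    · exact neg_injective (act_injective w h)
    · have := act_injective w h
      exact absurd (this ▸ hβ) (neg_notMem_posRoots hα)
    · have := act_injective w h
      exact absurd (this ▸ hα) (neg_notMem_posRoots hβ)
    · exact act_injective w h
  have himg : (posRoots n).image g = posRoots n :=
    eq_of_subset_of_card_le (image_subset_iff.2 hg) (card_image_of_injOn hinj).ge
  conv_lhs => rw [← himg, prod_image hinj]
  have : ∀ α ∈ posRoots n, act w v ⬝ᵥ g α =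
      (if -act w α ∈ posRoots n then -1 else 1) * (v ⬝ᵥ α) := fun α _ => by
    dsimp only [g]
    split_ifs
    · rw [dotProduct_neg, act_dotProduct_act, neg_one_mul]
    · rw [act_dotProduct_act, one_mul]
  rw [prod_congr rfl this, prod_mul_distrib, length, ← prod_filter, prod_const]

theorem prod_posRoots (g : Weight n → ℤ) :
    ∏ α ∈ posRoots n, g α =
      (∏ p : Fin n × Fin n with p.1 < p.2, g (e p.1 - e p.2) * g (e p.1 + e p.2)) *
        ∏ i, g ((2 : ℤ) • e i) := by
  classical
  have ev : ∀ i j : Fin n, e i j = if j = i then 1 else 0 := fun i j => by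
    simp [e, Pi.single_apply]
  have s1 : ∀ i : Fin n, ∑ k, e i k = 1 := fun i => by simp [e]
  rw [posRoots, prod_union, prod_union, prod_image, prod_image, prod_image, prod_mul_distrib]
  · intro i _ j _ h
    have := congrFun h i
    simp only [Pi.smul_apply, ev, smul_eq_mul] at this
    by_contra hne
    simp [hne] at this
  · rintro ⟨i, j⟩ hi ⟨i', j'⟩ hi' h
    simp only [coe_filter, mem_univ, true_and, Set.mem_ofPred_eq] at hi hi'
    have h1 := congrFun h i
    have h2 := congrFun h j
    have h3 := congrFun h i'
    have h4 := congrFun h j'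
    simp only [Pi.add_apply, ev] at h1 h2 h3 h4
    grind
  · rintro ⟨i, j⟩ hi ⟨i', j'⟩ hi' h
    simp only [coe_filter, mem_univ, true_and, Set.mem_ofPred_eq] at hi hi'
    have h1 := congrFun h i
    have h2 := congrFun h j
    have h3 := congrFun h i'
    have h4 := congrFun h j'
    simp only [Pi.sub_apply, ev] at h1 h2 h3 h4
    grind
  · rw [disjoint_left]
    intro α h1 h2
    simp only [mem_image, mem_filter, mem_univ, true_and, Prod.exists] at h1 h2
    obtain ⟨i, j, _, rfl⟩ := h1
    obtain ⟨i', j', _, h⟩ := h2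
    -- The coordinate sum is `0` for `e i - e j` and `2` for `e i + e j`.
    have := congrArg (fun x : Weight n => ∑ k, x k) h
    simp [sum_add_distrib, s1] at this
  · rw [disjoint_left]
    intro α h1 h2
    simp only [mem_union, mem_image, mem_filter, mem_univ, true_and, Prod.exists] at h1 h2
    obtain ⟨l, rfl⟩ := h2
    rcases h1 with ⟨i, j, hij, h⟩ | ⟨i, j, hij, h⟩
    · have := congrArg (fun x : Weight n => ∑ k, x k) h
      simp [s1, ← mul_sum] at this
    · have h1 := congrFun h i
      have h2 := congrFun h j
      have h3 := congrFun h l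
      simp only [Pi.add_apply, Pi.smul_apply, ev, smul_eq_mul] at h1 h2 h3
      grind

/-- The short-root factors `(v i - v j) * (v i + v j)` form a Vandermonde product in the squares;
the minus sign adjusts to the orientation of `Matrix.det_vandermonde`. -/
theorem prod_posRoots_dotProduct (v : Weight n) :
    ∏ α ∈ posRoots n, v ⬝ᵥ α =
      (Matrix.vandermonde fun i => -(v i) ^ 2).det * ∏ i, (2 * v i) := by
  rw [prod_posRoots, Matrix.det_vandermonde]
  congr 1
  · rw [prod_filter, ← univ_product_univ, prod_product]
    refine prod_congr rfl fun i _ => ?_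
    rw [← prod_filter]
    refine prod_congr (by ext; simp) fun j _ => ?_
    rw [dotProduct_sub, dotProduct_add, dotProduct_e, dotProduct_e]
    ring
  · refine prod_congr rfl fun i _ => ?_
    rw [dotProduct_smul, dotProduct_e, smul_eq_mul]

/-- The sign `(-1)^{l(w)}` is the determinant of the signed permutation `w`. -/
theorem neg_one_pow_length (w : Weyl n) :
    (-1 : ℤ) ^ length w = (Equiv.Perm.sign w.1 : ℤ) * ∏ i, (w.2 i : ℤ) := by
  -- The two signs are compared through their effect on this nonzero product: the permutation acts
  -- on the Vandermonde factor, the sign changes on the product of the coordinates.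
  have h0 : ∏ α ∈ posRoots n, rho n ⬝ᵥ α ≠ 0 :=
    prod_ne_zero_iff.2 fun α hα => (rho_dotProduct_pos hα).ne'
  refine mul_right_cancel₀ h0 ?_
  rw [← prod_posRoots_act, prod_posRoots_dotProduct, prod_posRoots_dotProduct]
  have h1 : (fun i => -(act w (rho n) i) ^ 2) = fun i => -(rho n (w.1.symm i)) ^ 2 := by
    ext i
    rcases Int.units_eq_one_or (w.2 i) with h | h <;> simp [act, h]
  have h2 : (Matrix.vandermonde fun i => -(rho n (w.1.symm i)) ^ 2) =
      (Matrix.vandermonde fun i => -(rho n i) ^ 2).submatrix w.1.symm id := by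
    ext; simp [Matrix.vandermonde_apply]
  rw [h1, h2, Matrix.det_permute, Equiv.Perm.sign_symm]
  have h3 : ∏ i, (2 * act w (rho n) i) = (∏ i, (w.2 i : ℤ)) * ∏ i, (2 * rho n i) := by
    rw [← Equiv.prod_comp w.1.symm (fun i => 2 * rho n i), ← prod_mul_distrib]
    refine prod_congr rfl fun i _ => ?_
    simp only [act]
    ring
  rw [h3]
  push_cast
  ring

end Sign

/-! ### The coefficients of `C μ` as determinants -/

/-- The odd delta function: `1` if `x = y`, `-1` if `-x = y`, and their sum if both hold. -/
def oddDelta (F : Type) [Field F] (x y : ℤ) : F :=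
  (if x = y then 1 else 0) - if -x = y then 1 else 0

theorem oddDelta_neg {F : Type} [Field F] (x y : ℤ) : oddDelta F (-x) y = -oddDelta F x y := by
  simp [oddDelta]

theorem oddDelta_zero {F : Type} [Field F] (y : ℤ) : oddDelta F 0 y = 0 := by
  simp [oddDelta]

theorem oddDelta_of_pos {F : Type} [Field F] {x y : ℤ} (hx : 0 ≤ x) (hy : 0 < y) :
    oddDelta F x y = if x = y then 1 else 0 := by
  rw [oddDelta, if_neg (show ¬ -x = y by omega), sub_zero]

theorem oddDelta_eq_sum {F : Type} [Field F] (x y : ℤ) :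
    oddDelta F x y = ∑ s : ℤˣ, ((s : ℤ) : F) * if (s : ℤ) * x = y then 1 else 0 := by
  rw [show (univ : Finset ℤˣ) = {1, -1} from rfl, sum_insert (by decide), sum_singleton]
  simp only [oddDelta, Units.val_one, Units.val_neg, Int.cast_one, Int.cast_neg, one_mul, neg_mul,
    sub_eq_add_neg]

/-- Leibniz expansion with every entry split over its two signs: a permutation and a choice of signs
make up a Weyl group element. The permutation is inverted because `act` uses `w.1.symm`. -/
theorem det_oddDelta {F : Type} [Field F] {n : ℕ} (x y : Weight n) :
    (Matrix.of fun a b => oddDelta F (x a) (y b)).det =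
      ∑ σ : Weyl n, (-1 : F) ^ length σ * if act σ x = y then 1 else 0 := by
  classical
  have hs : ∀ σ : Weyl n, (-1 : F) ^ length σ =
      ((Equiv.Perm.sign σ.1 : ℤ) : F) * ∏ i, ((σ.2 i : ℤ) : F) := fun σ => by
    exact_mod_cast congrArg (Int.cast : ℤ → F) (neg_one_pow_length σ)
  rw [Matrix.det_apply', ← univ_product_univ, sum_product, ← Equiv.sum_comp (Equiv.inv _)]
  refine sum_congr rfl fun τ _ => ?_
  simp only [Matrix.of_apply, oddDelta_eq_sum, prod_univ_sum, Fintype.piFinset_univ, mul_sum]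
  refine sum_congr rfl fun s _ => ?_
  rw [hs, prod_mul_distrib, prod_ite_zero, prod_const_one, Equiv.inv_apply,
    Equiv.Perm.sign_inv, mul_assoc]
  simp only [mem_univ, true_imp_iff, act, funext_iff]
  rfl

theorem C_apply {n : ℕ} (μ ν : Weight n) (h : IsDominant ν) :
    C μ ν = (Matrix.of fun a b => oddDelta RatQT ((μ + rho n) a) ((ν + rho n) b)).det := by
  classical
  rw [det_oddDelta, C, Finsupp.finsetSum_apply]
  refine sum_congr rfl fun σ _ => ?_
  by_cases h1 : act σ (μ + rho n) = ν + rho n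
  · rw [h1, add_sub_cancel_right, if_pos h]; simp
  · have h2 : act σ (μ + rho n) - rho n ≠ ν := fun h' => h1 (by rw [← h', sub_add_cancel])
    rw [if_neg h1]
    split_ifs <;> simp [h2]

theorem C_apply_of_not_isDominant {n : ℕ} (μ ν : Weight n) (h : ¬ IsDominant ν) : C μ ν = 0 := by
  classical
  rw [C, Finsupp.finsetSum_apply]
  refine sum_eq_zero fun σ _ => ?_
  split_ifs with h1
  · have h2 : act σ (μ + rho n) - rho n ≠ ν := fun h' => h (h' ▸ h1)
    simp [h2]
  · simp

/-! ### The pairs of the recurrence -/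

section Pairs

variable {n : ℕ}

/-- The weights with `j`-th coordinate `2` and other coordinates in `{-1, 0, 1}`, exactly `N` of
these being nonzero. -/
def signVectors (j : Fin n) (N : ℕ) : Finset (Weight n) :=
  {μ ∈ Fintype.piFinset fun a => if a = j then {2} else {-1, 0, 1} | #{a | a ≠ j ∧ μ a ≠ 0} = N}

theorem mem_signVectors {j : Fin n} {N : ℕ} {μ : Weight n} :
    μ ∈ signVectors j N ↔ μ j = 2 ∧ (∀ a, a ≠ j → μ a = -1 ∨ μ a = 0 ∨ μ a = 1) ∧
      #{a | a ≠ j ∧ μ a ≠ 0} = N := by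
  rw [signVectors, mem_filter, Fintype.mem_piFinset, ← and_assoc]
  refine and_congr_left fun _ => ⟨fun h => ⟨by simpa using h j, fun a ha => by
    simpa [ha] using h a⟩, fun h a => ?_⟩
  by_cases ha : a = j
  · subst ha; simpa using h.1
  · simpa [ha] using h.2 a ha

theorem theta_eq (hn : 0 < n) : theta n = (2 : ℤ) • e ⟨0, hn⟩ := by
  ext a
  simp [theta, omega, e, Pi.single_apply, Fin.ext_iff]

theorem lam_apply {k : ℕ} (a : Fin n) :
    lam n k a = if (a : ℕ) = 0 then 2 else if (a : ℕ) < 2 * k + 1 then 1 else 0 := by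
  simp only [lam, omega, Pi.add_apply]
  split_ifs <;> omega

theorem smul_e_apply (j a : Fin n) : ((2 : ℤ) • e j) a = if a = j then 2 else 0 := by
  simp [e, Pi.single_apply]

theorem smul_e_injective : Function.Injective fun j : Fin n => (2 : ℤ) • e j := fun i j h => by
  have h1 : ((2 : ℤ) • e i) i = ((2 : ℤ) • e j) i := congrFun h i
  by_contra hne
  rw [smul_e_apply, smul_e_apply, if_pos rfl, if_neg hne] at h1
  norm_num at h1

theorem act_theta (w : Weyl n) (hn : 0 < n) (h : act w (theta n) ∈ posRoots n) :
    w.2 (w.1 ⟨0, hn⟩) = 1 ∧ act w (theta n) = (2 : ℤ) • e (w.1 ⟨0, hn⟩) := by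
  rw [theta_eq hn, act_smul, act_e] at h ⊢
  rcases Int.units_eq_one_or (w.2 (w.1 ⟨0, hn⟩)) with h1 | h1
  · simp [h1]
  · rw [h1] at h
    exact absurd (by simpa using h) (neg_notMem_posRoots (posRoots_long (w.1 ⟨0, hn⟩)))

theorem card_filter_lt {N : ℕ} (h : N ≤ n) : #{a : Fin n | (a : ℕ) < N} = N := by
  rw [Fin.card_filter_val_lt, min_eq_right h]

theorem exists_perm_support {k : ℕ} (hn : 2 * k + 1 ≤ n) {j : Fin n} {μ : Weight n}
    (h : μ ∈ signVectors j (2 * k)) :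
    ∃ τ : Equiv.Perm (Fin n), τ ⟨0, by omega⟩ = j ∧ ∀ a, μ (τ a) ≠ 0 ↔ (a : ℕ) < 2 * k + 1 := by
  classical
  obtain ⟨h1, h2, h3⟩ := mem_signVectors.1 h
  have hc : #{a | μ a ≠ 0} = 2 * k + 1 := by
    have : (({a | μ a ≠ 0} : Finset (Fin n))) = insert j ({a | a ≠ j ∧ μ a ≠ 0} : Finset (Fin n)) := by
      ext a
      by_cases ha : a = j <;> simp [ha, h1]
    rw [this, card_insert_of_notMem (by simp), h3]
  have hcard : Fintype.card {a : Fin n // (a : ℕ) < 2 * k + 1} =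
      Fintype.card {a : Fin n // μ a ≠ 0} := by
    rw [Fintype.card_subtype, Fintype.card_subtype, card_filter_lt hn, hc]
  let ε := (Fintype.equivOfCardEq hcard).extendSubtype
  have hε : ∀ a, μ (ε a) ≠ 0 ↔ (a : ℕ) < 2 * k + 1 := fun a =>
    ⟨fun ha => by_contra fun hlt =>
      Equiv.extendSubtype_not_mem (Fintype.equivOfCardEq hcard) a hlt ha,
      fun ha => Equiv.extendSubtype_mem (Fintype.equivOfCardEq hcard) a ha⟩
  -- An arbitrary bijection of supports is corrected by a transposition inside the support of `μ`,
  -- so that `0` goes to `j`.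
  refine ⟨ε.trans (Equiv.swap (ε ⟨0, by omega⟩) j), by simp, fun a => ?_⟩
  rw [← hε, Equiv.trans_apply]
  have h0 : μ (ε ⟨0, by omega⟩) ≠ 0 := (hε _).2 (by simp)
  have hj : μ j ≠ 0 := by rw [h1]; norm_num
  rcases eq_or_ne (ε a) (ε ⟨0, by omega⟩) with h' | h'
  · rw [h', Equiv.swap_apply_left]; tauto
  · rcases eq_or_ne (ε a) j with h'' | h''
    · rw [h'', Equiv.swap_apply_right]; tauto
    · rw [Equiv.swap_apply_of_ne_of_ne h' h'']

/-- Positivity of `w θ` forces `w` to send the first basis vector to some `+e j`; the other entries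
of `lam`, `2 * k` ones and zeros, are permuted and signed arbitrarily. -/
theorem pairs_lam {k : ℕ} (hn : 2 * k + 1 ≤ n) :
    pairs (lam n k) =
      ((univ : Finset (Fin n)).sigma fun j => signVectors j (2 * k)).image
        fun s => (s.2, (2 : ℤ) • e s.1) := by
  classical
  have hn0 : 0 < n := by omega
  ext ⟨μ, β⟩
  simp only [pairs, mem_filter, mem_image, mem_univ, true_and, mem_sigma, Prod.mk.injEq,
    Sigma.exists]
  constructor
  · rintro ⟨⟨w, rfl, rfl⟩, hw⟩
    obtain ⟨h1, h2⟩ := act_theta w hn0 hw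
    refine ⟨w.1 ⟨0, hn0⟩, _, mem_signVectors.2 ⟨?_, fun a ha => ?_, ?_⟩, rfl, h2.symm⟩
    · simp [act, h1, lam_apply]
    · have : (w.1.symm a : ℕ) ≠ 0 := fun h => ha (by
        rw [← w.1.apply_symm_apply a]; congr 1; exact Fin.ext h)
      rw [act, lam_apply, if_neg this]
      rcases Int.units_eq_one_or (w.2 a) with h | h <;> rw [h] <;> split_ifs <;> simp
    · have h3 : ({a | a ≠ w.1 ⟨0, hn0⟩ ∧ act w (lam n k) a ≠ 0} : Finset (Fin n)) =
          (({a | (a : ℕ) < 2 * k + 1} : Finset (Fin n)).erase ⟨0, hn0⟩).map w.1.toEmbedding := by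
        ext a
        obtain ⟨a, rfl⟩ := w.1.surjective a
        have h4 : ((w.2 (w.1 a) : ℤˣ) : ℤ) ≠ 0 := Units.ne_zero _
        simp only [mem_filter, mem_univ, true_and, mem_map_equiv, mem_erase,
          Equiv.symm_apply_apply, act, mul_ne_zero_iff, lam_apply, w.1.injective.ne_iff]
        refine and_congr_right fun h5 => ?_
        rw [if_neg fun h => h5 (Fin.ext h)]
        split_ifs <;> simp_all
      rw [h3, card_map, card_erase_of_mem (by simp), card_filter_lt hn, Nat.add_sub_cancel]
  · rintro ⟨j, μ, hμ, rfl, rfl⟩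
    refine ⟨?_, posRoots_long j⟩
    obtain ⟨τ, h1, h2⟩ := exists_perm_support hn hμ
    obtain ⟨h3, h4, -⟩ := mem_signVectors.1 hμ
    refine ⟨(τ, fun a => if μ a = -1 then -1 else 1), ?_, ?_⟩
    · ext a
      obtain ⟨a, rfl⟩ := τ.surjective a
      simp only [act, Equiv.symm_apply_apply, lam_apply]
      have h2a := h2 a
      by_cases ha : (a : ℕ) = 0
      · obtain rfl : a = ⟨0, hn0⟩ := Fin.ext ha
        rw [h1, h3]; simp
      · have hne : τ a ≠ j := fun h => ha (by rw [← h1] at h; rw [τ.injective h])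
        rw [if_neg ha]
        rcases h4 _ hne with h | h | h <;> rw [h] at h2a ⊢ <;> simp at h2a <;> simp [h2a]
    · rw [theta_eq hn0, act_smul, act_e]
      simp only [h1, h3]
      simp

end Pairs

/-! ### Determinants with one exceptional row -/

section Expansion

variable {F : Type} [Field F] {n : ℕ}

theorem det_row_sum {ι R : Type} [CommRing R] (s : Finset ι) (c : ι → R) (r : ι → Fin n → R)
    (M : Matrix (Fin n) (Fin n) R) (j : Fin n) :
    ∑ i ∈ s, c i * (M.updateRow j (r i)).det = (M.updateRow j (∑ i ∈ s, c i • r i)).det := by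
  simp only [← Matrix.cramer_transpose_apply, map_sum, map_smul, Finset.sum_apply, Pi.smul_apply,
    smul_eq_mul]

/-- Multilinearity in the rows: each row other than `j` is a sum over the shifts `-1, 0, 1`, and
nonzero shifts carry a factor `X`, so the exponent counts them. -/
theorem coeff_det_signVectors (j : Fin n) (x y : Fin n → ℤ) (D : Fin n → F) (N : ℕ) :
    (Matrix.updateRow (Matrix.of fun a b => Polynomial.C (oddDelta F (x a) (y b)) +
        X * Polynomial.C (oddDelta F (x a + 1) (y b) + oddDelta F (x a - 1) (y b))) j
        fun b => Polynomial.C (D b)).det.coeff N =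
      ∑ μ ∈ signVectors j N,
        (Matrix.updateRow (Matrix.of fun a b => oddDelta F (x a + μ a) (y b)) j D).det := by
  classical
  let A : Fin n → Finset ℤ := fun a => if a = j then {2} else {-1, 0, 1}
  let g : Fin n → ℤ → Fin n → F[X] := fun a c b =>
    (if a ≠ j ∧ c ≠ 0 then X else 1) *
      Polynomial.C (if a = j then D b else oddDelta F (x a + c) (y b))
  have h1 : (Matrix.updateRow (Matrix.of fun a b => Polynomial.C (oddDelta F (x a) (y b)) +
        X * Polynomial.C (oddDelta F (x a + 1) (y b) + oddDelta F (x a - 1) (y b))) j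
        fun b => Polynomial.C (D b)) =
      Matrix.of fun a => ∑ c ∈ A a, g a c := by
    refine Matrix.ext fun a b => ?_
    by_cases ha : a = j
    · subst ha
      simp [A, g, Finset.sum_apply]
    · rw [Matrix.updateRow_ne ha]
      simp [A, g, Finset.sum_apply, ha, sub_eq_add_neg]
      ring
  have h2 : (Matrix.of fun a => ∑ c ∈ A a, g a c).det =
      ∑ μ ∈ Fintype.piFinset A, (Matrix.of fun a => g a (μ a)).det :=
    (Matrix.detRowAlternating (R := F[X]) (n := Fin n)).toMultilinearMap.map_sum_finset g A
  rw [h1, h2, finsetSum_coeff, signVectors, sum_filter]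
  refine sum_congr rfl fun μ _ => ?_
  have h3 : (Matrix.of fun a => g a (μ a)).det =
      X ^ #{a | a ≠ j ∧ μ a ≠ 0} * Polynomial.C
        (Matrix.updateRow (Matrix.of fun a b => oddDelta F (x a + μ a) (y b)) j D).det := by
    have := Matrix.det_mul_column (fun a => if a ≠ j ∧ μ a ≠ 0 then (X : F[X]) else 1)
      ((Polynomial.C : F →+* F[X]).mapMatrix
        (Matrix.updateRow (Matrix.of fun a b => oddDelta F (x a + μ a) (y b)) j D))
    rw [← RingHom.map_det, ← prod_filter, prod_const] at this
    rw [← this]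
    congr 1
    refine Matrix.ext fun a b => ?_
    simp only [g, Matrix.of_apply, RingHom.mapMatrix_apply, Matrix.map_apply,
      Matrix.updateRow_apply]
  rw [h3, coeff_X_pow_mul']
  split_ifs with h4 h5 h5
  · rw [h5, Nat.sub_self, coeff_C_zero]
  · rw [coeff_C_of_ne_zero (by omega)]
  · omega
  · rfl

end Expansion

/-! ### The recurrence as a polynomial determinant -/

section Recurrence

variable {F : Type} [Field F]

/-- The bracket `f_i(q, t) - q² f_i(q⁻¹, t⁻¹)`. -/
noncomputable def stepCoeff (q t : F) (m i : ℕ) : F := f q t m i - q ^ 2 * f q⁻¹ t⁻¹ m i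

/-- The value at `v` of `∑_i [f_i(q, t) - q² f_i(q⁻¹, t⁻¹)] δ_{m + 2 - 2i}`, where `δ` is the odd
delta function and `m = (ρ, β^∨)`. -/
noncomputable def diffRow (q t : F) (m : ℕ) (v : ℤ) : F :=
  ∑ i ∈ range (m + 2), stepCoeff q t m i * oddDelta F (m + 2 - 2 * i) v

/-- The value at `v` of `δ_m + X (δ_{m + 1} + δ_{m - 1})`. -/
noncomputable def pathRow (F : Type) [Field F] (m : ℕ) (v : ℤ) : F[X] :=
  Polynomial.C (oddDelta F m v) +
    X * Polynomial.C (oddDelta F (m + 1) v + oddDelta F (m - 1) v)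

/-- The matrix with rows `pathRow 1, ..., pathRow n`. -/
noncomputable def pathMatrix (F : Type) [Field F] {n : ℕ} (y : Fin n → ℤ) :
    Matrix (Fin n) (Fin n) F[X] :=
  Matrix.of fun a b => pathRow F (a + 1) (y b)

/-- The sum over the rows of `pathMatrix` of the determinant with that row replaced by
`diffRow`. -/
noncomputable def detSum (q t : F) {n : ℕ} (y : Fin n → ℤ) : F[X] :=
  ∑ j : Fin n,
    ((pathMatrix F y).updateRow j fun b => Polynomial.C (diffRow q t (j + 1) (y b))).det

theorem corootPairing_rho {n : ℕ} (j : Fin n) :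
    corootPairing (rho n) ((2 : ℤ) • e j) = rho n j := by
  have : e j j = 1 := by simp [e]
  rw [corootPairing, dotProduct_smul, dotProduct_smul, smul_dotProduct, dotProduct_e, dotProduct_e,
    this]
  simp only [smul_eq_mul]
  omega

theorem corootPairing_lam {n : ℕ} (k : ℕ) (hn : 0 < n) :
    corootPairing (lam n k) (theta n) = 2 := by
  have : e (⟨0, hn⟩ : Fin n) ⟨0, hn⟩ = 1 := by simp [e]
  rw [corootPairing, theta_eq hn, dotProduct_smul, dotProduct_smul, smul_dotProduct, dotProduct_e,
    dotProduct_e, this, lam_apply]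
  simp

/-- Reversing rows and columns simultaneously costs no sign and replaces the decreasing entries of
`ρ` by the row numbers `1, ..., n`. -/
theorem det_pathMatrix_rev {n : ℕ} (y : Fin n → ℤ) (D : ℤ → F) (j : Fin n) :
    ((pathMatrix F fun b => y b.rev).updateRow j.rev fun b => Polynomial.C (D (y b.rev))).det =
      (Matrix.updateRow (Matrix.of fun a b => Polynomial.C (oddDelta F (rho n a) (y b)) +
        X * Polynomial.C (oddDelta F (rho n a + 1) (y b) + oddDelta F (rho n a - 1) (y b))) j
        fun b => Polynomial.C (D (y b))).det := by
  rw [← Matrix.det_submatrix_equiv_self Fin.revPerm]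
  congr 1
  refine Matrix.ext fun a b => ?_
  have h : ((a.rev : ℕ) : ℤ) + 1 = rho n a := by
    have := a.2
    simp only [rho, Fin.val_rev]
    omega
  simp only [Matrix.submatrix_apply, Fin.revPerm_apply, Matrix.updateRow_apply, Fin.rev_inj,
    Fin.rev_rev, pathMatrix, Matrix.of_apply, pathRow, Nat.cast_add, Nat.cast_one, h]

/-- A single polynomial contains all the recurrences: `k` enters only through the exponent.
Combining recurrences therefore means applying a linear functional to this polynomial. -/
theorem R_apply_eq_coeff {n k : ℕ} (hn : 2 * k + 1 ≤ n) {ν : Weight n} (hν : IsDominant ν) :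
    R n k ν = (detSum q t fun b => (ν + rho n) b.rev).coeff (2 * k) := by
  classical
  have hinj : Set.InjOn (fun s : (_ : Fin n) × Weight n => (s.2, (2 : ℤ) • e s.1))
      (univ.sigma fun j => signVectors j (2 * k) : Finset ((_ : Fin n) × Weight n)) := by
    rintro ⟨j, μ⟩ _ ⟨j', μ'⟩ _ h
    obtain ⟨h1, h2⟩ := Prod.mk.inj h
    obtain rfl : μ = μ' := h1
    obtain rfl := smul_e_injective h2
    rfl
  rw [R, recurrence, pairs_lam hn, sum_image hinj, sum_sigma, Finsupp.finsetSum_apply, detSum,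
    finsetSum_coeff, ← Equiv.sum_comp Fin.revPerm (fun j' => Polynomial.coeff _ _)]
  refine sum_congr rfl fun j _ => ?_
  have hm : (rho n j).toNat = (j.rev : ℕ) + 1 := by
    have := j.2
    simp only [rho, Fin.val_rev]
    omega
  have hm' : rho n j = ((j.rev : ℕ) + 1 : ℕ) := by
    have := j.2
    simp only [rho, Fin.val_rev]
    omega
  rw [Fin.revPerm_apply, det_pathMatrix_rev (ν + rho n) (diffRow q t (j.rev + 1)),
    coeff_det_signVectors, Finsupp.finsetSum_apply]
  refine sum_congr rfl fun μ hμ => ?_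
  have hμj := (mem_signVectors.1 hμ).1
  rw [Finsupp.finsetSum_apply]
  simp only [corootPairing_rho, corootPairing_lam k (show 0 < n by omega), Finsupp.smul_apply,
    smul_eq_mul, C_apply _ _ hν, hm]
  have h1 : (fun b => diffRow q t (j.rev + 1) ((ν + rho n) b)) =
      ∑ i ∈ range (j.rev + 1 + 2), stepCoeff q t (j.rev + 1) i •
        fun b => oddDelta RatQT (((j.rev : ℕ) + 1 : ℕ) + 2 - 2 * i) ((ν + rho n) b) := by
    ext b
    simp [diffRow, Finset.sum_apply]
  rw [h1, ← det_row_sum]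
  refine sum_congr rfl fun i _ => ?_
  congr 2
  refine Matrix.ext fun a b => ?_
  rw [Matrix.updateRow_apply, Matrix.of_apply]
  have h2 : (μ - (i : ℤ) • (2 : ℤ) • e j + rho n) a = μ a - i * (if a = j then 2 else 0) + rho n a := by
    rw [← smul_e_apply]; rfl
  rw [h2]
  split_ifs with h3
  · subst h3
    rw [hμj, hm']
    congr 1
    ring
  · rw [Matrix.of_apply]
    congr 1
    ring

end Recurrence

/-! ### Closed form of `diffRow` -/

section DiffRow

variable {F : Type} [Field F]

/-- The coefficient of `δ_{m + 2}` in `diffRow`. -/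
noncomputable def topCoeff (q t : F) (m : ℕ) : F := (t ^ m)⁻¹ - q ^ 2 * t ^ m

/-- The coefficient of `δ_{m - 2}` in `diffRow`, up to the regular part. -/
noncomputable def lowCoeff (q t : F) (m : ℕ) : F := t ^ m - q ^ 2 * (t ^ m)⁻¹

/-- The coefficient of `δ_m` in `diffRow`, up to the regular part. -/
noncomputable def diagCoeff (q t : F) (m : ℕ) : F :=
  (t - 1) * (t - q) * (t ^ m - q * (t ^ (m + 2))⁻¹)

/-- The common factor of the regular part of `diffRow`. -/
noncomputable def kappa (q t : F) : F := (t - 1) * (t - q) * (t ^ 2 + q) / t ^ 2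

/-- `t^{-m} - t^m`. -/
noncomputable def antisymPow (t : F) (m : ℕ) : F := (t ^ m)⁻¹ - t ^ m

/-- The regular part of `diffRow`, up to the factor `kappa`. -/
noncomputable def regularRow (t : F) (m v : ℕ) : F :=
  if v ≤ m ∧ m % 2 = v % 2 then antisymPow t v else 0

theorem genPoly_eq_sum (a b : F) (m : ℕ) :
    genPoly a b m = ∑ s ∈ range m, (Polynomial.C (b ^ (2 * s)) * X ^ s +
      Polynomial.C (-(b + a * b) * b ^ (2 * s)) * X ^ (s + 1) +
      Polynomial.C (a * b ^ 2 * b ^ (2 * s)) * X ^ (s + 2)) := by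
  rw [genPoly, mul_sum]
  refine sum_congr rfl fun s _ => ?_
  simp only [map_mul, map_pow, map_neg, map_add, mul_pow]
  ring

/-- Reorders the sum by the terms of the geometric series in `genPoly`; the quadratic factor spreads
each of them over three consecutive indices. -/
theorem sum_f_mul (a b : F) (hb : b ≠ 0) (m : ℕ) (g : ℕ → F) :
    ∑ i ∈ range (m + 2), f a b m i * g i =
      ∑ s ∈ range m, (b ^ m)⁻¹ * b ^ (2 * s) *
        (g s - (b + a * b) * g (s + 1) + a * b ^ 2 * g (s + 2)) := by
  have h1 : ∑ i ∈ range (m + 2), (genPoly a b m).coeff i * g i =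
      (genPoly a b m).sum fun i c => c * g i := by
    rw [Polynomial.sum_def]
    refine (sum_subset (fun i hi => ?_) fun i _ hi => ?_).symm
    · rw [mem_support_iff] at hi
      by_contra h
      have := f_eq_zero a b m i (by simpa using h)
      rw [f] at this
      exact hi ((mul_eq_zero.1 this).resolve_left (inv_ne_zero (pow_ne_zero _ hb)))
    · rw [notMem_support_iff.1 hi, zero_mul]
  have h2 : ∀ p : F[X], p.sum (fun i c => c * g i) =
      Polynomial.lsum (fun i => LinearMap.mulRight F (g i)) p := fun p => rfl
  have h3 : ∀ (c : F) (i : ℕ),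
      Polynomial.lsum (fun i => LinearMap.mulRight F (g i)) (Polynomial.C c * X ^ i) = c * g i :=
    fun c i => by
      rw [← h2, C_mul_X_pow_eq_monomial, sum_monomial_index c (fun i c => c * g i) (zero_mul _)]
  have h4 : ∀ i, f a b m i * g i = (b ^ m)⁻¹ * ((genPoly a b m).coeff i * g i) := fun i => by
    rw [f]; ring
  simp only [h4]
  rw [← mul_sum, h1, h2, genPoly_eq_sum, map_sum, mul_sum]
  refine sum_congr rfl fun s _ => ?_
  simp only [map_add, h3]
  ring

theorem sum_range_shift_two (b : F) (hb : b ≠ 0) (m : ℕ) (φ : ℤ → F) :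
    ∑ s ∈ range (m + 2), (b ^ (m + 2))⁻¹ * b ^ (2 * s) * φ ((m + 2 : ℕ) - 2 * s) =
      (b ^ (m + 2))⁻¹ * φ (m + 2) + b ^ m * φ (-m) +
        ∑ s ∈ range m, (b ^ m)⁻¹ * b ^ (2 * s) * φ (m - 2 * s) := by
  rw [sum_range_succ, sum_range_succ']
  have h : ∀ s ∈ range m, (b ^ (m + 2))⁻¹ * b ^ (2 * (s + 1)) * φ ((m + 2 : ℕ) - 2 * (s + 1 : ℕ)) =
      (b ^ m)⁻¹ * b ^ (2 * s) * φ (m - 2 * s) := fun s _ => by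
    rw [show ((m + 2 : ℕ) : ℤ) - 2 * (s + 1 : ℕ) = m - 2 * s by push_cast; ring]
    congr 1
    field_simp
    ring
  rw [sum_congr rfl h, show ((m + 2 : ℕ) : ℤ) - 2 * (m + 1 : ℕ) = -m by push_cast; ring]
  have h2 : (b ^ (m + 2))⁻¹ * b ^ (2 * (m + 1)) = b ^ m := by
    field_simp
    ring
  rw [h2]
  simp
  ring

theorem regularRow_add_two (t : F) (m v : ℕ) (hv : 0 < v) :
    regularRow t (m + 2) v = regularRow t m v + antisymPow t (m + 2) * oddDelta F (m + 2) v := by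
  rw [oddDelta_of_pos (by positivity) (by exact_mod_cast hv), regularRow, regularRow]
  by_cases h : v = m + 2
  · subst h
    simp
  · rw [if_neg (show ¬ (m : ℤ) + 2 = v by omega), mul_zero, add_zero]
    congr 1
    exact propext (by omega)

/-- By `sum_range_shift_two` the row for `m + 2` adds only the two outermost terms to that for `m`.
Oddness folds the one around `-m` back to positive positions, where it cancels the old term at `m -
2`. -/
theorem diffRow_eq {q t : F} (hq : q ≠ 0) (ht : t ≠ 0) (m v : ℕ) (hv : 0 < v) :
    diffRow q t m v = topCoeff q t m * oddDelta F (m + 2) v + lowCoeff q t m * oddDelta F (m - 2) v +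
      diagCoeff q t m * oddDelta F m v + kappa q t * regularRow t m v := by
  have hv' : (0 : ℤ) < v := by exact_mod_cast hv
  let ψ : F → F → ℤ → F := fun a b x => oddDelta F (x + 2) v -
    (b + a * b) * oddDelta F x v + a * b ^ 2 * oddDelta F (x - 2) v
  have h1 : ∀ (a b : F), b ≠ 0 → ∀ m : ℕ, ∑ i ∈ range (m + 2), f a b m i *
      oddDelta F (m + 2 - 2 * i) v =
        ∑ s ∈ range m, (b ^ m)⁻¹ * b ^ (2 * s) * ψ a b (m - 2 * s) := fun a b hb m => by
    rw [sum_f_mul a b hb m fun i => oddDelta F (m + 2 - 2 * i) v]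
    refine sum_congr rfl fun s _ => ?_
    simp only [ψ]
    push_cast
    ring_nf
  have h2 : ∀ m : ℕ, diffRow q t m v =
      (∑ s ∈ range m, (t ^ m)⁻¹ * t ^ (2 * s) * ψ q t (m - 2 * s)) -
        q ^ 2 * ∑ s ∈ range m, (t⁻¹ ^ m)⁻¹ * t⁻¹ ^ (2 * s) * ψ q⁻¹ t⁻¹ (m - 2 * s) := fun m => by
    rw [← h1 q t ht, ← h1 q⁻¹ t⁻¹ (inv_ne_zero ht), mul_sum, ← sum_sub_distrib, diffRow]
    refine sum_congr rfl fun i _ => ?_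
    rw [stepCoeff]
    ring
  have e0 := oddDelta_zero (F := F) v
  have e1 : oddDelta F (-1) v = -oddDelta F 1 v := oddDelta_neg 1 _
  have e2 : oddDelta F (-2) v = -oddDelta F 2 v := oddDelta_neg 2 _
  induction m using Nat.twoStepInduction with
  | zero =>
    rw [h2]
    simp [topCoeff, lowCoeff, e0, e2, regularRow, hv.ne']
  | one =>
    have h3 : regularRow t 1 v = antisymPow t 1 * oddDelta F 1 v := by
      rw [oddDelta_of_pos zero_le_one hv', regularRow]
      by_cases h : v = 1
      · subst h; simp
      · rw [if_neg (by omega), if_neg (by omega), mul_zero]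
    rw [h2, h3]
    simp only [ψ, topCoeff, lowCoeff, diagCoeff, kappa, antisymPow, sum_range_one]
    norm_num
    rw [e1]
    field_simp
    ring
  | more m ih _ =>
    rw [h2, sum_range_shift_two t ht, sum_range_shift_two t⁻¹ (inv_ne_zero ht),
      regularRow_add_two t m v hv]
    rw [h2] at ih
    have e3 : oddDelta F (-(m : ℤ) + 2) v = -oddDelta F (m - 2) v := by
      rw [← oddDelta_neg]; congr 1; ring
    have e4 : oddDelta F (-(m : ℤ) - 2) v = -oddDelta F (m + 2) v := by
      rw [← oddDelta_neg]; congr 1; ring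
    have e5 := oddDelta_neg (F := F) m v
    have e6 : oddDelta F ((m : ℤ) + 2 - 2) v = oddDelta F m v := by congr 1; ring
    -- Here `x, y, z, w` stand for the odd deltas at `m + 4, m + 2, m, m - 2`, and `A, B` for the
    -- inner sums.
    have key : ∀ x y z w A B c r : F, A - q ^ 2 * B = topCoeff q t m * y + lowCoeff q t m * w +
        diagCoeff q t m * z + kappa q t * r →
      (t ^ (m + 2))⁻¹ * (x - (t + q * t) * y + q * t ^ 2 * z) +
          t ^ m * (-w - (t + q * t) * -z + q * t ^ 2 * -y) + A -
        q ^ 2 * ((t⁻¹ ^ (m + 2))⁻¹ * (x - (t⁻¹ + q⁻¹ * t⁻¹) * y + q⁻¹ * t⁻¹ ^ 2 * z) +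
          t⁻¹ ^ m * (-w - (t⁻¹ + q⁻¹ * t⁻¹) * -z + q⁻¹ * t⁻¹ ^ 2 * -y) + B) =
      topCoeff q t (m + 2) * x + lowCoeff q t (m + 2) * z + diagCoeff q t (m + 2) * y +
        kappa q t * (r + antisymPow t (m + 2) * y) := by
      intro x y z w A B c r h
      obtain rfl : A = q ^ 2 * B + (topCoeff q t m * y + lowCoeff q t m * w +
        diagCoeff q t m * z + kappa q t * r) := by rw [← h]; ring
      simp only [topCoeff, lowCoeff, diagCoeff, kappa, antisymPow, pow_add, inv_pow]
      generalize hT : t ^ m = T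
      have hT' : T ≠ 0 := hT ▸ pow_ne_zero _ ht
      field_simp
      ring
    simp only [ψ, e3, e4, e5, e6, Nat.cast_add, Nat.cast_ofNat]
    simp only [ψ] at ih
    exact key _ _ _ _ _ _ 0 _ ih

end DiffRow

/-! ### Determinants with a sparse last row or column -/

section LastColumn

variable {S : Type} [CommRing S] {n : ℕ}

theorem det_eq_of_last_col (M : Matrix (Fin (n + 1)) (Fin (n + 1)) S)
    (h : ∀ i : Fin n, M i.castSucc (Fin.last n) = 0) :
    M.det = M (Fin.last n) (Fin.last n) * (M.submatrix Fin.castSucc Fin.castSucc).det := by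
  rw [Matrix.det_succ_column M (Fin.last n), Fin.sum_univ_castSucc]
  simp only [h, mul_zero, zero_mul, sum_const_zero, zero_add, Fin.succAbove_last]
  simp [← two_mul]

theorem det_eq_of_last_row (M : Matrix (Fin (n + 1)) (Fin (n + 1)) S)
    (h : ∀ i : Fin n, M (Fin.last n) i.castSucc = 0) :
    M.det = M (Fin.last n) (Fin.last n) * (M.submatrix Fin.castSucc Fin.castSucc).det := by
  rw [← Matrix.det_transpose, det_eq_of_last_col _ (by simpa using h), ← Matrix.transpose_submatrix,
    Matrix.det_transpose, Matrix.transpose_apply]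

theorem submatrix_updateRow_castSucc {T : Type} (M : Matrix (Fin (n + 1)) (Fin (n + 1)) T)
    (j : Fin n) (r : Fin (n + 1) → T) :
    (M.updateRow j.castSucc r).submatrix Fin.castSucc Fin.castSucc =
      (M.submatrix Fin.castSucc Fin.castSucc).updateRow j fun b => r b.castSucc := by
  refine Matrix.ext fun a b => ?_
  simp only [Matrix.submatrix_apply, Matrix.updateRow_apply, Fin.castSucc_inj]

/-- Replacing a row by a vector with arbitrary last entry, in a matrix whose last column is
otherwise concentrated in the last row. -/
theorem det_updateRow_castSucc (M : Matrix (Fin (n + 1)) (Fin (n + 1)) S)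
    (h : ∀ i : Fin n, M i.castSucc (Fin.last n) = 0) (j : Fin n) (r : Fin (n + 1) → S) :
    (M.updateRow j.castSucc r).det =
      M (Fin.last n) (Fin.last n) *
          ((M.submatrix Fin.castSucc Fin.castSucc).updateRow j fun b => r b.castSucc).det -
        r (Fin.last n) * ((M.submatrix Fin.castSucc Fin.castSucc).updateRow j
          fun b => M (Fin.last n) b.castSucc).det := by
  classical
  -- `r` is split into a row with last entry `0` and a multiple of the last unit vector. For the
  -- latter, row `j` is swapped with the last row, which produces the minus sign.
  let r0 : Fin (n + 1) → S := Fin.snoc (fun b => r b.castSucc) 0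
  have hr : r = r0 + r (Fin.last n) • Pi.single (Fin.last n) 1 := by
    ext b
    refine Fin.lastCases ?_ (fun b => ?_) b
    · simp [r0]
    · simp [r0, (Fin.castSucc_lt_last b).ne]
  have h1 : (M.updateRow j.castSucc r0).det = M (Fin.last n) (Fin.last n) *
      ((M.submatrix Fin.castSucc Fin.castSucc).updateRow j fun b => r b.castSucc).det := by
    rw [det_eq_of_last_col, submatrix_updateRow_castSucc,
      Matrix.updateRow_ne (Fin.castSucc_lt_last j).ne']
    · simp [r0]
    · intro i
      rw [Matrix.updateRow_apply]
      split_ifs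
      · simp [r0]
      · exact h i
  have h2 : (M.updateRow j.castSucc (Pi.single (Fin.last n) 1)).det =
      -((M.submatrix Fin.castSucc Fin.castSucc).updateRow j
          fun b => M (Fin.last n) b.castSucc).det := by
    have hne := (Fin.castSucc_lt_last j).ne
    rw [← neg_eq_iff_eq_neg, ← neg_one_mul]
    have := Matrix.det_permute (Equiv.swap j.castSucc (Fin.last n))
      (M.updateRow j.castSucc (Pi.single (Fin.last n) 1))
    rw [Equiv.Perm.sign_swap hne] at this
    simp only [Units.val_neg, Units.val_one, Int.cast_neg, Int.cast_one] at this
    rw [← this, det_eq_of_last_row]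
    · rw [Matrix.submatrix_apply, Equiv.swap_apply_right, Matrix.updateRow_self]
      simp only [id, Pi.single_eq_same, one_mul]
      congr 1
      refine Matrix.ext fun a b => ?_
      rw [Matrix.submatrix_submatrix, Matrix.submatrix_apply]
      simp only [Function.comp_apply, id]
      by_cases h3 : a = j
      · rw [h3, Equiv.swap_apply_left, Matrix.updateRow_ne hne.symm, Matrix.updateRow_self]
      · have h4 : a.castSucc ≠ j.castSucc := by simpa using h3
        rw [Equiv.swap_apply_of_ne_of_ne h4 (Fin.castSucc_lt_last a).ne, Matrix.updateRow_ne h4,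
          Matrix.updateRow_ne h3, Matrix.submatrix_apply]
    · intro i
      rw [Matrix.submatrix_apply, Equiv.swap_apply_right, Matrix.updateRow_self]
      simp [(Fin.castSucc_lt_last i).ne]
  conv_lhs => rw [hr]
  rw [Matrix.det_updateRow_add, Matrix.det_updateRow_smul, h1, h2]
  ring

end LastColumn

/-! ### Minors of the path matrix -/

section Minors

variable {F : Type} [Field F]

theorem pathRow_apply {m v : ℕ} (hm : 0 < m) (hv : 0 < v) :
    pathRow F m v = (if m = v then 1 else 0) +
      X * ((if m + 1 = v then 1 else 0) + if m = v + 1 then 1 else 0) := by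
  have hv' : (0 : ℤ) < v := by exact_mod_cast hv
  rw [pathRow, oddDelta_of_pos (by positivity) hv', oddDelta_of_pos (by positivity) hv',
    oddDelta_of_pos (by omega) hv']
  have h1 : ((m : ℤ) = v) ↔ m = v := by omega
  have h2 : ((m : ℤ) + 1 = v) ↔ m + 1 = v := by omega
  have h3 : ((m : ℤ) - 1 = v) ↔ m = v + 1 := by omega
  simp only [h1, h2, h3, map_add]
  split_ifs <;> simp

/-- The increasing enumeration of the positive integers different from `r`. -/
def skip (r b : ℕ) : ℕ := if b + 1 < r then b + 1 else b + 2

theorem skip_of_le {r b : ℕ} (h : r ≤ b + 1) : skip r b = b + 2 := if_neg (not_lt.2 h)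

theorem skip_of_lt {r b : ℕ} (h : b + 1 < r) : skip r b = b + 1 := if_pos h

theorem skip_pos (r b : ℕ) : 0 < skip r b := by rw [skip]; split_ifs <;> omega

/-- The path matrix with columns `1, 2, ...`, the column `r` being left out. -/
noncomputable def skipMatrix (F : Type) [Field F] (n r : ℕ) : Matrix (Fin n) (Fin n) F[X] :=
  pathMatrix F fun b => (skip r b : ℤ)

theorem skipMatrix_apply (n r : ℕ) (a b : Fin n) :
    skipMatrix F n r a b = (if (a : ℕ) + 1 = skip r b then 1 else 0) +
      X * ((if (a : ℕ) + 2 = skip r b then 1 else 0) + if (a : ℕ) = skip r b then 1 else 0) := by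
  rw [skipMatrix, pathMatrix, Matrix.of_apply]
  have := pathRow_apply (F := F) (Nat.succ_pos a) (skip_pos r b)
  simpa using this

theorem skipMatrix_apply_of_eq {n r i s : ℕ} {a b : Fin n} (ha : (a : ℕ) = i) (hs : skip r b = s) :
    skipMatrix F n r a b = (if i + 1 = s then 1 else 0) +
      X * ((if i + 2 = s then 1 else 0) + if i = s then 1 else 0) := by
  rw [skipMatrix_apply, ha, hs]

theorem skipMatrix_submatrix (n r : ℕ) :
    (skipMatrix F (n + 1) r).submatrix Fin.castSucc Fin.castSucc = skipMatrix F n r := by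
  refine Matrix.ext fun a b => ?_
  simp only [Matrix.submatrix_apply, skipMatrix_apply, Fin.val_castSucc]

theorem skipMatrix_castSucc_last {n r : ℕ} (hr : r ≤ n + 1) (i : Fin n) :
    skipMatrix F (n + 1) r i.castSucc (Fin.last n) = 0 := by
  have := i.2
  rw [skipMatrix_apply, Fin.val_castSucc, Fin.val_last, skip_of_le hr, if_neg (by omega), if_neg (by omega),
    if_neg (by omega)]
  simp

theorem skipMatrix_last_last {n r : ℕ} (hr : r ≤ n + 1) :
    skipMatrix F (n + 1) r (Fin.last n) (Fin.last n) = X := by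
  rw [skipMatrix_apply, Fin.val_last, skip_of_le hr, if_neg (by omega), if_pos rfl,
    if_neg (by omega)]
  simp

/-- The sum of a tridiagonal row against a sequence. -/
theorem sum_skipMatrix_mul {n r : ℕ} (hr : n < r) (i : Fin n) (h : ℕ → F[X]) (h0 : h 0 = 0)
    (h1 : h (n + 1) = 0) :
    ∑ b : Fin n, skipMatrix F n r i b * h (b + 1) = h (i + 1) + X * (h i + h (i + 2)) := by
  have hi := i.2
  have e1 : ∀ b : Fin n, skipMatrix F n r i b * h (b + 1) =
      (if (i : ℕ) = b then h (b + 1) else 0) + X * ((if (i : ℕ) + 1 = b then h (b + 1) else 0) +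
        if (i : ℕ) = b + 1 then h (b + 1) else 0) := fun b => by
    have hb := b.2
    rw [skipMatrix_apply, skip_of_lt (by omega)]
    simp only [add_left_inj, show (i : ℕ) + 2 = b + 1 ↔ (i : ℕ) + 1 = b by omega]
    split_ifs <;> first | omega | simp
  have e2 : ∑ b : Fin n, (if (i : ℕ) = b + 1 then h (b + 1) else 0) = h i := by
    rw [Fin.sum_univ_eq_sum_range (fun b => if (i : ℕ) = b + 1 then h (b + 1) else 0)]
    rcases Nat.eq_zero_or_pos (i : ℕ) with h' | h'
    · rw [h', h0]; simp
    · rw [sum_eq_single_of_mem ((i : ℕ) - 1) (by simp; omega), if_pos (by omega),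
        Nat.sub_add_cancel h']
      intro b _ hb
      rw [if_neg (by omega)]
  rw [sum_congr rfl fun b _ => e1 b, sum_add_distrib, ← mul_sum, sum_add_distrib, e2,
    Fin.sum_univ_eq_sum_range (fun b => if (i : ℕ) = b then h (b + 1) else 0),
    Fin.sum_univ_eq_sum_range (fun b => if (i : ℕ) + 1 = b then h (b + 1) else 0),
    sum_ite_eq, sum_ite_eq, if_pos (by simp), add_comm (h i)]
  congr 3
  split_ifs with h'
  · rfl
  · rw [mem_range] at h'
    rw [show (i : ℕ) + 2 = n + 1 by omega, h1]

/-- The cofactors of the path matrix with columns `1, ..., n`; rows and columns are numbered from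
`1`. -/
noncomputable def pathCofactor (F : Type) [Field F] (n v m : ℕ) : F[X] :=
  if v ≤ m then (-X) ^ (m - v) * (pathPoly F v * pathPoly F (n + 1 - m))
  else (-X) ^ (v - m) * (pathPoly F m * pathPoly F (n + 1 - v))

/-- Away from the diagonal, a row applied to the cofactors is the three-term recursion of
`pathPoly`; on the diagonal the two branches meet and the edge-cutting identity applies. -/
theorem skipMatrix_mul_pathCofactor {n r : ℕ} (hr : n < r) :
    (skipMatrix F n r * Matrix.of fun v m : Fin n => pathCofactor F n (v + 1) (m + 1)) =
      pathPoly F (n + 1) • (1 : Matrix (Fin n) (Fin n) F[X]) := by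
  refine Matrix.ext fun i m => ?_
  simp only [Matrix.mul_apply, Matrix.of_apply, Matrix.smul_apply, smul_eq_mul, Matrix.one_apply]
  have hi := i.2
  have hm := m.2
  rw [sum_skipMatrix_mul hr i fun v => pathCofactor F n v (m + 1)]
  · rcases lt_trichotomy i m with h | rfl | h
    · rw [if_neg h.ne, mul_zero]
      have h : (i : ℕ) < m := h
      obtain ⟨d, hd⟩ : ∃ d, (m : ℕ) = i + 1 + d := ⟨m - (i + 1), by omega⟩
      simp only [pathCofactor, hd]
      rw [if_pos (by omega), if_pos (by omega), if_pos (by omega), pathPoly_add_two,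
        show (i : ℕ) + 1 + d + 1 - (i + 1) = d + 1 by omega,
        show (i : ℕ) + 1 + d + 1 - i = d + 2 by omega,
        show (i : ℕ) + 1 + d + 1 - (i + 2) = d by omega]
      ring
    · rw [if_pos rfl, mul_one]
      simp only [pathCofactor]
      obtain ⟨d, hd⟩ : ∃ d, n = i + 1 + d := ⟨n - (i + 1), by omega⟩
      rw [if_pos le_rfl, if_pos (by omega), if_neg (by omega),
        show (i : ℕ) + 1 - i = 1 by omega, show (i : ℕ) + 2 - (i + 1) = 1 by omega,
        show n + 1 - (i + 1) = d + 1 by omega, show n + 1 - (i + 2) = d by omega,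
        show n + 1 = i + (d + 1) + 1 by omega]
      have e1 := pathPoly_mul_succ (F := F) i (d + 1)
      have e2 := pathPoly_add_two (F := F) d
      rw [show d + 1 + 1 = d + 2 by ring, e2] at e1
      simp
      linear_combination e1
    · rw [if_neg h.ne', mul_zero]
      have h : (m : ℕ) < i := h
      obtain ⟨d, hd⟩ : ∃ d, (i : ℕ) = m + 1 + d := ⟨i - (m + 1), by omega⟩
      obtain ⟨c, hc⟩ : ∃ c, n = i + 1 + c := ⟨n - (i + 1), by omega⟩
      have e1 : pathCofactor F n i (m + 1) =
          (-X) ^ d * (pathPoly F (m + 1) * pathPoly F (c + 2)) := by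
        rcases Nat.eq_zero_or_pos d with h' | h'
        · rw [pathCofactor, if_pos (by omega), show (m : ℕ) + 1 - i = d by omega,
            show (i : ℕ) = m + 1 by omega, show n + 1 - ((m : ℕ) + 1) = c + 2 by omega]
        · rw [pathCofactor, if_neg (by omega), show (i : ℕ) - (m + 1) = d by omega,
            show n + 1 - (i : ℕ) = c + 2 by omega]
      rw [e1, pathCofactor, if_neg (by omega), pathCofactor, if_neg (by omega),
        show (i : ℕ) + 1 - (m + 1) = d + 1 by omega, show (i : ℕ) + 2 - (m + 1) = d + 2 by omega,
        show n + 1 - ((i : ℕ) + 1) = c + 1 by omega, show n + 1 - ((i : ℕ) + 2) = c by omega,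
        pathPoly_add_two c]
      ring
  · simp [pathCofactor]
  · simp only [pathCofactor]
    rw [if_neg (by omega)]
    simp

/-- Multiply the preceding identity by the adjugate and compare the last diagonal entries: the last
cofactor is the determinant one size smaller, and the nonzero path polynomial cancels. -/
theorem det_skipMatrix_of_lt {n r : ℕ} (hr : n < r) :
    (skipMatrix F n r).det = pathPoly F (n + 1) := by
  induction n generalizing r with
  | zero => simp
  | succ n ih =>
    have h1 := congrArg (fun M => (skipMatrix F (n + 1) r).adjugate * M)
      (skipMatrix_mul_pathCofactor (F := F) hr)
    simp only [← Matrix.mul_assoc, Matrix.adjugate_mul, Matrix.mul_smul, Matrix.mul_one,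
      Matrix.smul_mul, Matrix.one_mul] at h1
    have h2 := congrFun (congrFun h1 (Fin.last n)) (Fin.last n)
    simp only [Matrix.smul_apply, Matrix.of_apply, smul_eq_mul, Matrix.adjugate_fin_succ_eq_det_submatrix,
      Fin.succAbove_last, skipMatrix_submatrix, Fin.val_last] at h2
    rw [ih (by omega), pathCofactor, if_pos le_rfl, ← two_mul] at h2
    simp only [Nat.sub_self, pow_zero, one_mul, Nat.add_sub_cancel_left, pathPoly_one, mul_one,
      pow_mul, neg_one_sq, one_pow] at h2
    refine mul_right_cancel₀ (pathPoly_ne_zero (F := F) n) ?_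
    simpa using h2

theorem adjugate_skipMatrix {n r : ℕ} (hr : n < r) :
    (skipMatrix F n r).adjugate =
      Matrix.of fun v m : Fin n => pathCofactor F n (v + 1) (m + 1) := by
  have h1 := congrArg (fun M => (skipMatrix F n r).adjugate * M)
    (skipMatrix_mul_pathCofactor (F := F) hr)
  simp only [← Matrix.mul_assoc, Matrix.adjugate_mul, Matrix.mul_smul, Matrix.mul_one,
    Matrix.smul_mul, Matrix.one_mul, det_skipMatrix_of_lt hr] at h1
  refine Matrix.ext fun v m => ?_
  have h2 := congrFun (congrFun h1 v) m
  simp only [Matrix.smul_apply, smul_eq_mul] at h2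
  exact (mul_left_cancel₀ (pathPoly_ne_zero (F := F) n) h2).symm

/-- Each column beyond the gap contributes a factor `X`: in the truncated matrix the last column is
`X` in the last row and zero above. -/
theorem det_skipMatrix_add (r d : ℕ) :
    (skipMatrix F (r + d) (r + 1)).det = X ^ d * pathPoly F (r + 1) := by
  induction d with
  | zero => rw [add_zero, det_skipMatrix_of_lt (Nat.lt_succ_self r), pow_zero, one_mul]
  | succ d ih =>
    rw [← add_assoc, det_eq_of_last_col _ (skipMatrix_castSucc_last (by omega)),
      skipMatrix_last_last (by omega), skipMatrix_submatrix, ih]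
    ring

end Minors

/-! ### The determinant sums without gap in the columns -/

section Conv

variable {F : Type} [Field F]

/-- `∑ w_m P_m P_{N + 1 - m}`, the sum over `1 ≤ m ≤ N`. -/
noncomputable def conv (w : ℕ → F) (N : ℕ) : F[X] :=
  ∑ m ∈ range N, Polynomial.C (w (m + 1)) * (pathPoly F (m + 1) * pathPoly F (N - m))

theorem conv_add (w w' : ℕ → F) (N : ℕ) :
    conv w N + conv w' N = conv (fun m => w m + w' m) N := by
  simp only [conv, ← sum_add_distrib, map_add]
  exact sum_congr rfl fun _ _ => by ring

theorem C_mul_conv (c : F) (w : ℕ → F) (N : ℕ) :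
    Polynomial.C c * conv w N = conv (fun m => c * w m) N := by
  simp only [conv, mul_sum, map_mul]
  exact sum_congr rfl fun _ _ => by ring

theorem conv_congr {w w' : ℕ → F} (h : ∀ m, w (m + 1) = w' (m + 1)) (N : ℕ) :
    conv w N = conv w' N := by
  simp only [conv, h]

/-- Edge cutting replaces every product by the common `P_{N+2}` and a shorter product; the weight
gets shifted by one. -/
theorem conv_add_two (w : ℕ → F) (N : ℕ) :
    conv w (N + 2) = Polynomial.C (∑ m ∈ range (N + 2), w (m + 1)) * pathPoly F (N + 2) +
      X ^ 2 * conv (fun m => w (m + 1)) N := by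
  have h1 : ∀ m ∈ range (N + 2),
      Polynomial.C (w (m + 1)) * (pathPoly F (m + 1) * pathPoly F (N + 2 - m)) =
        Polynomial.C (w (m + 1)) * pathPoly F (N + 2) +
          X ^ 2 * (Polynomial.C (w (m + 1)) * (pathPoly F m * pathPoly F (N + 1 - m))) := by
    intro m hm
    have hm := mem_range.1 hm
    have := pathPoly_mul_succ (F := F) m (N + 1 - m)
    rw [show N + 1 - m + 1 = N + 2 - m by omega, show m + (N + 1 - m) + 1 = N + 2 by omega] at this
    rw [this]
    ring
  have h2 : ∑ m ∈ range (N + 2), Polynomial.C (w (m + 1)) * (pathPoly F m * pathPoly F (N + 1 - m)) =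
      conv (fun m => w (m + 1)) N := by
    rw [sum_range_succ, sum_range_succ']
    simp only [pathPoly_zero, Nat.sub_self, zero_mul, mul_zero, add_zero, conv,
      Nat.add_sub_add_right]
  rw [conv, sum_congr rfl h1, sum_add_distrib, ← sum_mul, ← map_sum, ← mul_sum, h2]

/-- The sum `∑ s_v X^{m - v} P_v` over the `v ≤ m` of the parity of `m`. -/
noncomputable def regularTail (t : F) (m : ℕ) : F[X] :=
  ∑ v ∈ range m, Polynomial.C (regularRow t m (v + 1)) *
    ((-X) ^ (m - (v + 1)) * pathPoly F (v + 1))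

theorem regularTail_add_two (t : F) (m : ℕ) :
    regularTail t (m + 2) = X ^ 2 * regularTail t m +
      Polynomial.C (antisymPow t (m + 2)) * pathPoly F (m + 2) := by
  rw [regularTail, sum_range_succ, sum_range_succ]
  have h1 : regularRow t (m + 2) (m + 1) = 0 := by
    rw [regularRow, if_neg (by omega)]
  have h2 : regularRow t (m + 2) (m + 1 + 1) = antisymPow t (m + 2) := by
    rw [regularRow, if_pos (by omega)]
  rw [h1, h2, regularTail, mul_sum, map_zero, zero_mul, add_zero, Nat.sub_self, pow_zero, one_mul]
  refine congrArg₂ (· + ·) ?_ rfl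
  refine sum_congr rfl fun v hv => ?_
  have hv := mem_range.1 hv
  have h3 : regularRow t (m + 2) (v + 1) = regularRow t m (v + 1) := by
    simp only [regularRow, show v + 1 ≤ m + 2 ∧ (m + 2) % 2 = (v + 1) % 2 ↔
      v + 1 ≤ m ∧ m % 2 = (v + 1) % 2 by omega]
  rw [h3, show m + 2 - (v + 1) = m - (v + 1) + 2 by omega]
  ring

theorem regularTail_one (t : F) : regularTail t 1 = Polynomial.C (antisymPow t 1) := by
  simp [regularTail, regularRow]

theorem regularTail_two (t : F) : regularTail t 2 = Polynomial.C (antisymPow t 2) := by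
  rw [regularTail_add_two]; simp [regularTail]

/-- The contribution of the regular parts of the rows to the determinant sum. -/
noncomputable def regularSum (t : F) (N : ℕ) : F[X] :=
  ∑ m ∈ range N, regularTail t (m + 1) * pathPoly F (N - m)

theorem regularSum_add_two (t : F) (N : ℕ) :
    regularSum t (N + 2) = conv (antisymPow t) (N + 2) + X ^ 2 * regularSum t N := by
  rw [regularSum, conv, sum_range_succ', sum_range_succ', sum_range_succ' _ (N + 1),
    sum_range_succ' _ N, regularSum, mul_sum]
  have h : ∀ m ∈ range N, regularTail t (m + 1 + 1 + 1) * pathPoly F (N + 2 - (m + 1 + 1)) =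
      Polynomial.C (antisymPow t (m + 1 + 1 + 1)) *
        (pathPoly F (m + 1 + 1 + 1) * pathPoly F (N + 2 - (m + 1 + 1))) +
      X ^ 2 * (regularTail t (m + 1) * pathPoly F (N - m)) := fun m _ => by
    rw [regularTail_add_two, Nat.add_sub_add_right]
    ring
  rw [sum_congr rfl h, sum_add_distrib]
  simp only [zero_add, regularTail_one, Nat.reduceAdd, regularTail_two, pathPoly_one, pathPoly_two]
  ring

theorem sum_regularRow_mul_pathCofactor (t : F) {N m : ℕ} (hm : m ≤ N) :
    ∑ v : Fin N, Polynomial.C (regularRow t m (v + 1)) * pathCofactor F N (v + 1) m =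
      regularTail t m * pathPoly F (N + 1 - m) := by
  rw [Fin.sum_univ_eq_sum_range
    (fun v => Polynomial.C (regularRow t m (v + 1)) * pathCofactor F N (v + 1) m),
    regularTail, sum_mul]
  refine (sum_subset_zero_on_sdiff (range_subset_range.2 hm) (fun v hv => ?_) fun v hv => ?_).symm
  · rw [mem_sdiff, mem_range, mem_range] at hv
    rw [regularRow, if_neg (by omega), map_zero, zero_mul]
  · rw [mem_range] at hv
    rw [pathCofactor, if_pos (by omega)]
    ring

theorem sum_oddDelta_mul (N x : ℕ) (h : ℕ → F[X]) (h0 : h 0 = 0) (hN : ∀ v, N < v → h v = 0) :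
    ∑ b : Fin N, Polynomial.C (oddDelta F x ((b + 1 : ℕ) : ℤ)) * h (b + 1) = h x := by
  have e : ∀ b : Fin N, Polynomial.C (oddDelta F x ((b + 1 : ℕ) : ℤ)) * h (b + 1) =
      if x = (b : ℕ) + 1 then h (b + 1) else 0 := fun b => by
    rw [oddDelta_of_pos (by positivity) (by positivity)]
    simp only [Nat.cast_inj]
    split_ifs <;> simp
  rw [sum_congr rfl fun b _ => e b,
    Fin.sum_univ_eq_sum_range (fun b => if x = b + 1 then h (b + 1) else 0)]
  rcases x with _ | x
  · rw [h0]; simp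
  · simp only [add_left_inj, sum_ite_eq, mem_range]
    split_ifs with h'
    · rfl
    · rw [hN _ (by omega)]

end Conv

/-! ### Expansion of the gap-free determinant sums in path polynomials. -/

section NoGap

variable {F : Type} [Field F] {q t : F}

theorem det_updateRow_eq_sum {S : Type} [CommRing S] {n : ℕ} (M : Matrix (Fin n) (Fin n) S)
    (j : Fin n) (r : Fin n → S) :
    (M.updateRow j r).det = ∑ b, r b * M.adjugate b j := by
  rw [← Matrix.cramer_transpose_apply, Matrix.cramer_eq_adjugate_mulVec, ← Matrix.adjugate_transpose,
    Matrix.mulVec, dotProduct]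
  exact sum_congr rfl fun b _ => by rw [Matrix.transpose_apply, mul_comm]

/-- The determinant sum for the columns `1, 2, ...`, the column `r` being left out. -/
noncomputable def skipSum (q t : F) (n r : ℕ) : F[X] := detSum q t fun b : Fin n => (skip r b : ℤ)

theorem pathCofactor_of_lt {n v m : ℕ} (hv : n < v) : pathCofactor F n v m = 0 ∨ v ≤ m := by
  rw [or_iff_not_imp_right]
  intro h
  rw [pathCofactor, if_neg h, show n + 1 - v = 0 by omega]
  simp

/-- Laplace expansion along the exceptional row. Row `1` is special because `δ_{-1} = -δ_1`. -/
theorem skipSum_row (hq : q ≠ 0) (ht : t ≠ 0) {n m : ℕ} (hm : 0 < m) (hmn : m ≤ n) :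
    ∑ b : Fin n, Polynomial.C (diffRow q t m ((b + 1 : ℕ) : ℤ)) * pathCofactor F n (b + 1) m =
      Polynomial.C (topCoeff q t m) * pathCofactor F n (m + 2) m +
      Polynomial.C (lowCoeff q t m) *
        (if m = 1 then -pathPoly F n else pathCofactor F n (m - 2) m) +
      Polynomial.C (diagCoeff q t m) * pathCofactor F n m m +
      Polynomial.C (kappa q t) * (regularTail t m * pathPoly F (n + 1 - m)) := by
  have h0 : pathCofactor F n 0 m = 0 := by simp [pathCofactor]
  have hN : ∀ v, n < v → pathCofactor F n v m = 0 := fun v hv =>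
    (pathCofactor_of_lt hv).resolve_right (by omega)
  rw [← sum_regularRow_mul_pathCofactor t hmn]
  have e1 := sum_oddDelta_mul n (m + 2) (fun v => pathCofactor F n v m) h0 hN
  have e2 := sum_oddDelta_mul n m (fun v => pathCofactor F n v m) h0 hN
  have e3 : ∑ b : Fin n, Polynomial.C (oddDelta F (m - 2) ((b + 1 : ℕ) : ℤ)) *
      pathCofactor F n (b + 1) m =
        if m = 1 then -pathPoly F n else pathCofactor F n (m - 2) m := by
    split_ifs with h
    · subst h
      have := sum_oddDelta_mul n 1 (fun v => pathCofactor F n v 1) h0 hN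
      have h' : pathCofactor F n 1 1 = pathPoly F n := by simp [pathCofactor]
      rw [← h', ← this, ← sum_neg_distrib]
      refine sum_congr rfl fun b _ => ?_
      rw [show ((1 : ℕ) : ℤ) - 2 = -((1 : ℕ) : ℤ) by norm_num, oddDelta_neg, map_neg, neg_mul]
    · rw [← sum_oddDelta_mul n (m - 2) (fun v => pathCofactor F n v m) h0 hN]
      rw [Nat.cast_sub (by omega)]
      rfl
  rw [← e1, ← e2, ← e3]
  simp only [mul_sum, ← sum_add_distrib]
  refine sum_congr rfl fun b _ => ?_
  rw [diffRow_eq hq ht m (b + 1) (Nat.succ_pos _)]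
  simp only [map_add, map_mul]
  push_cast
  ring

theorem skipSum_eq_sum (hq : q ≠ 0) (ht : t ≠ 0) {n r : ℕ} (hr : n < r) :
    skipSum q t n r = ∑ m ∈ range n,
      (Polynomial.C (topCoeff q t (m + 1)) * pathCofactor F n (m + 3) (m + 1) +
      Polynomial.C (lowCoeff q t (m + 1)) *
        (if m = 0 then -pathPoly F n else pathCofactor F n (m - 1) (m + 1)) +
      Polynomial.C (diagCoeff q t (m + 1)) * (pathPoly F (m + 1) * pathPoly F (n - m)) +
      Polynomial.C (kappa q t) * (regularTail t (m + 1) * pathPoly F (n - m))) := by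
  rw [skipSum, detSum, ← Fin.sum_univ_eq_sum_range (fun m => _ + _)]
  refine sum_congr rfl fun j _ => ?_
  have hj := j.2
  have h := skipSum_row hq ht (Nat.succ_pos j) (Nat.succ_le_of_lt hj)
  rw [det_updateRow_eq_sum]
  change ∑ b, _ * (skipMatrix F n r).adjugate b j = _
  rw [adjugate_skipMatrix hr]
  have h3 : ∀ b : Fin n, (skip r b : ℤ) = ((b + 1 : ℕ) : ℤ) := fun b => by
    rw [skip_of_lt (by omega)]
  simp only [Matrix.of_apply, h3]
  refine h.trans ?_
  have h4 : pathCofactor F n (j + 1) (j + 1) = pathPoly F (j + 1) * pathPoly F (n - j) := by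
    simp [pathCofactor]
  simp only [Nat.succ_eq_add_one, show (j : ℕ) + 1 = 1 ↔ (j : ℕ) = 0 by omega,
    Nat.add_sub_add_right, h4, add_assoc,
    show (j : ℕ) + 1 - 2 = j - 1 by omega, Nat.reduceAdd]

/-- The cofactors at distance two on either side of the diagonal agree, so `topCoeff` at `m` pairs
with `lowCoeff` at `m + 2`. The last term comes from `δ_{-1}` in row `1`. -/
theorem skipSum_add_two (hq : q ≠ 0) (ht : t ≠ 0) {n r : ℕ} (hr : n + 2 < r) :
    skipSum q t (n + 2) r = conv (diagCoeff q t) (n + 2) +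
      Polynomial.C (kappa q t) * regularSum t (n + 2) +
      X ^ 2 * conv (fun m => topCoeff q t m + lowCoeff q t (m + 2)) n -
      Polynomial.C (lowCoeff q t 1) * pathPoly F (n + 2) := by
  rw [skipSum_eq_sum hq ht hr, sum_add_distrib, sum_add_distrib, sum_add_distrib, ← mul_sum,
    ← regularSum, ← conv, ← conv_add]
  have h1 : ∑ m ∈ range (n + 2),
      Polynomial.C (topCoeff q t (m + 1)) * pathCofactor F (n + 2) (m + 3) (m + 1) =
        X ^ 2 * conv (topCoeff q t) n := by
    have e : ∀ m, pathCofactor F (n + 2) (m + 3) (m + 1) =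
        X ^ 2 * (pathPoly F (m + 1) * pathPoly F (n - m)) := fun m => by
      rw [pathCofactor, if_neg (by omega), show m + 3 - (m + 1) = 2 by omega,
        show n + 2 + 1 - (m + 3) = n - m by omega]
      ring
    rw [sum_range_succ, sum_range_succ, conv, mul_sum]
    simp only [e]
    rw [show n - (n + 1) = 0 by omega, Nat.sub_self]
    simp only [pathPoly_zero, mul_zero, add_zero]
    exact sum_congr rfl fun m _ => by ring
  have h2 : ∑ m ∈ range (n + 2), Polynomial.C (lowCoeff q t (m + 1)) *
        (if m = 0 then -pathPoly F (n + 2) else pathCofactor F (n + 2) (m - 1) (m + 1)) =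
      X ^ 2 * conv (fun m => lowCoeff q t (m + 2)) n -
        Polynomial.C (lowCoeff q t 1) * pathPoly F (n + 2) := by
    have e : ∀ m, pathCofactor F (n + 2) (m + 1) (m + 3) =
        X ^ 2 * (pathPoly F (m + 1) * pathPoly F (n - m)) := fun m => by
      rw [pathCofactor, if_pos (by omega), show m + 3 - (m + 1) = 2 by omega,
        show n + 2 + 1 - (m + 3) = n - m by omega]
      ring
    rw [sum_range_succ', sum_range_succ', conv, mul_sum]
    have e0 : pathCofactor F (n + 2) 0 2 = 0 := by simp [pathCofactor]
    simp only [Nat.add_eq_zero_iff, one_ne_zero, and_false, if_false, Nat.add_sub_cancel, if_true,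
      zero_add, Nat.sub_self, Nat.reduceAdd, e0, mul_zero, add_zero]
    rw [mul_neg, ← sub_eq_add_neg]
    congr 1
    refine sum_congr rfl fun m _ => ?_
    rw [show m + 1 + 1 + 1 = m + 3 by ring, e]
    ring
  rw [h1, h2]
  ring

/-- The weight whose partial sums are the coefficients in the expansion of the determinant sums. -/
noncomputable def stepWeight (q t : F) (m : ℕ) : F :=
  (t - q) * (t ^ 2 + q) / t ^ 2 * (t ^ (m + 1) + (t ^ m)⁻¹)

/-- Absorbing the regular part lowers the index of the weight by one, which will undo the shift in
`conv_add_two`. -/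
theorem stepWeight_succ_add (ht : t ≠ 0) (m : ℕ) :
    stepWeight q t (m + 1) + kappa q t * antisymPow t (m + 1) = stepWeight q t m := by
  simp only [stepWeight, kappa, antisymPow, pow_succ]
  have := pow_ne_zero m ht
  field_simp
  ring

/-- The weights collected at distances zero and two, once a layer has been split off, add up to
`stepWeight` again. -/
theorem stepWeight_succ (ht : t ≠ 0) (m : ℕ) :
    stepWeight q t (m + 1) =
      diagCoeff q t (m + 1) + (topCoeff q t m + lowCoeff q t (m + 2)) := by
  simp only [stepWeight, diagCoeff, topCoeff, lowCoeff, pow_succ]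
  have := pow_ne_zero m ht
  field_simp
  ring

/-- The coefficient `Γ_0`, as a sum; `p` stands for `n - 2k`. -/
noncomputable def stableCoeff (q t : F) (p : ℕ) : F := ∑ m ∈ range p, stepWeight q t m

theorem stableCoeff_eq (ht : t ≠ 0) (ht1 : t ≠ 1) (p : ℕ) :
    stableCoeff q t p =
      (t ^ 2 + q) * (t - q) * (t ^ (2 * p) - 1) / (t ^ (p + 1) * (t - 1)) := by
  have h1 := sub_ne_zero.2 ht1
  induction p with
  | zero => simp [stableCoeff]
  | succ p ih =>
    rw [stableCoeff, sum_range_succ, ← stableCoeff, ih]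
    simp only [stepWeight, pow_succ, mul_add, mul_one, pow_mul]
    have := pow_ne_zero p ht
    field_simp
    ring

/-- The part of the determinant sum that is governed by `stableCoeff`. -/
noncomputable def stablePart (q t : F) (N : ℕ) : F[X] :=
  conv (stepWeight q t) N + Polynomial.C (kappa q t) * regularSum t N

theorem stablePart_zero : stablePart q t 0 = 0 := by simp [stablePart, conv, regularSum]

theorem stablePart_one (ht : t ≠ 0) :
    stablePart q t 1 = Polynomial.C (stableCoeff q t 1) * pathPoly F 1 := by
  have := stepWeight_succ_add (q := q) ht 0
  simp [stablePart, conv, regularSum, regularTail_one, stableCoeff, ← this]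

/-- The form of `stablePart` is self-reproducing: `stepWeight_succ_add` lowers the index of the
weight and `conv_add_two` raises it back, leaving the partial sum as coefficient. -/
theorem stablePart_add_two (ht : t ≠ 0) (N : ℕ) :
    stablePart q t (N + 2) = Polynomial.C (stableCoeff q t (N + 2)) * pathPoly F (N + 2) +
      X ^ 2 * stablePart q t N := by
  have h : conv (fun m => stepWeight q t m + kappa q t * antisymPow t m) (N + 2) =
      conv (fun m => stepWeight q t (m - 1)) (N + 2) :=
    conv_congr (fun m => stepWeight_succ_add ht m) _
  rw [stablePart, regularSum_add_two, mul_add, C_mul_conv, ← add_assoc, conv_add, h, conv_add_two,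
    stablePart, stableCoeff]
  simp only [Nat.add_sub_cancel]
  ring

/-- Only the outermost layer deviates from the pattern of `stablePart`. The value of `c` is not
needed, since the functional kills its term at every weight whose coefficient is asserted
explicitly. -/
theorem skipSum_add_two_eq (hq : q ≠ 0) (ht : t ≠ 0) {n r : ℕ} (hr : n + 2 < r) :
    ∃ c : F, skipSum q t (n + 2) r =
      Polynomial.C c * pathPoly F (n + 2) + X ^ 2 * stablePart q t n := by
  have h : conv (stepWeight q t) n = conv (fun m => diagCoeff q t (m + 1)) n +
      (conv (fun m => kappa q t * antisymPow t (m + 1)) n +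
        conv (fun m => topCoeff q t m + lowCoeff q t (m + 2)) n) := by
    rw [conv_add, conv_add]
    refine conv_congr (fun m => ?_) n
    rw [← stepWeight_succ_add ht, stepWeight_succ ht (m + 1)]
    ring
  rw [skipSum_add_two hq ht hr, regularSum_add_two, conv_add_two, conv_add_two, stablePart, h,
    ← C_mul_conv]
  refine ⟨∑ m ∈ range (n + 2), diagCoeff q t (m + 1) +
    kappa q t * ∑ m ∈ range (n + 2), antisymPow t (m + 1) - lowCoeff q t 1, ?_⟩
  simp only [map_add, map_sub, map_mul]
  ring

theorem skipSum_zero (r : ℕ) : skipSum q t 0 r = 0 := by simp [skipSum, detSum]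

theorem skipSum_one (hq : q ≠ 0) (ht : t ≠ 0) {r : ℕ} (hr : 1 < r) :
    ∃ c : F, skipSum q t 1 r = Polynomial.C c * pathPoly F 1 := by
  rw [skipSum_eq_sum hq ht hr, sum_range_one]
  refine ⟨-lowCoeff q t 1 + diagCoeff q t 1 + kappa q t * antisymPow t 1, ?_⟩
  have : pathCofactor F 1 3 1 = 0 := by simp [pathCofactor]
  simp [this, regularTail_one]

end NoGap

/-! ### The determinant sums with a gap or a large last column -/

section Gap

variable {F : Type} [Field F] {q t : F}

theorem oddDelta_eq_zero {x y : ℤ} (h1 : x ≠ y) (h2 : -x ≠ y) : oddDelta F x y = 0 := by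
  rw [oddDelta, if_neg h1, if_neg h2, sub_zero]

theorem pathRow_eq_zero {m : ℕ} {v : ℤ} (h : (m : ℤ) + 1 < v) : pathRow F m v = 0 := by
  rw [pathRow, oddDelta_eq_zero, oddDelta_eq_zero, oddDelta_eq_zero]
  · simp
  all_goals omega

theorem diffRow_eq_zero {m : ℕ} {v : ℤ} (h : (m : ℤ) + 2 < v) : diffRow q t m v = 0 := by
  refine sum_eq_zero fun i hi => ?_
  have := mem_range.1 hi
  rw [oddDelta_eq_zero, mul_zero] <;> omega

theorem diffRow_of_lt (hq : q ≠ 0) (ht : t ≠ 0) {m v : ℕ} (hm : 0 < m) (h : m < v) :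
    diffRow q t m v = if v = m + 2 then topCoeff q t m else 0 := by
  rw [diffRow_eq hq ht m v (by omega), oddDelta_of_pos (by positivity) (by omega),
    oddDelta_eq_zero (x := (m : ℤ)) (by omega) (by omega), oddDelta_eq_zero (x := (m : ℤ) - 2) (by omega) (by omega), regularRow,
    if_neg (show ¬ (v ≤ m ∧ _) by omega)]
  simp only [show ((m : ℤ) + 2 = v) ↔ v = m + 2 by omega, mul_zero, add_zero, mul_ite, mul_one]

theorem skipSum_succ (hq : q ≠ 0) (ht : t ≠ 0) {n r : ℕ} (hr : r ≤ n + 1) :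
    skipSum q t (n + 1) r = X * skipSum q t n r -
      ∑ j : Fin n, Polynomial.C (diffRow q t (j + 1) ((n + 2 : ℕ) : ℤ)) *
        ((skipMatrix F n r).updateRow j
          fun b => skipMatrix F (n + 1) r (Fin.last n) b.castSucc).det := by
  have hz := skipMatrix_castSucc_last (F := F) hr
  have hs : skip r n = n + 2 := skip_of_le hr
  rw [skipSum, detSum, Fin.sum_univ_castSucc]
  change ∑ j : Fin n, ((skipMatrix F (n + 1) r).updateRow j.castSucc _).det +
    ((skipMatrix F (n + 1) r).updateRow (Fin.last n) _).det = _
  have h0 : ((skipMatrix F (n + 1) r).updateRow (Fin.last n)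
      fun b => Polynomial.C (diffRow q t ((Fin.last n : Fin (n + 1)) + 1) (skip r b))).det = 0 := by
    refine Matrix.det_eq_zero_of_column_eq_zero (Fin.last n) fun i => ?_
    refine Fin.lastCases ?_ (fun i => ?_) i
    · rw [Matrix.updateRow_self, Fin.val_last, hs, diffRow_of_lt hq ht (by omega) (by omega),
        if_neg (by omega), map_zero]
    · rw [Matrix.updateRow_ne (Fin.castSucc_lt_last i).ne, hz]
  rw [h0, add_zero, skipSum, detSum, mul_sum, ← sum_sub_distrib]
  refine sum_congr rfl fun j _ => ?_
  rw [det_updateRow_castSucc _ hz, skipMatrix_last_last hr, skipMatrix_submatrix, Fin.val_last, hs]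
  rfl

/-- Among the `diffRow`s only that of row `n + 1` reaches the last column `n + 3`. In the correction
this row is replaced by path row `n + 2`, whose last remaining entry is `X` or `1` according as
column `n + 2` is missing or present. -/
theorem skipSum_succ_succ (hq : q ≠ 0) (ht : t ≠ 0) {n r : ℕ} (hr : r ≤ n + 2) :
    skipSum q t (n + 2) r = X * skipSum q t (n + 1) r - Polynomial.C (topCoeff q t (n + 1)) *
      ((if r = n + 2 then X else 1) * (skipMatrix F n r).det) := by
  have hlast : ((skipMatrix F (n + 1) r).updateRow (Fin.last n)
      fun b => skipMatrix F (n + 2) r (Fin.last (n + 1)) b.castSucc).det =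
        (if r = n + 2 then X else 1) * (skipMatrix F n r).det := by
    split_ifs with h
    · rw [det_eq_of_last_row]
      · rw [Matrix.updateRow_self, skipMatrix_apply_of_eq rfl (skip_of_lt (by simp; omega))]
        simp only [Fin.val_last, Fin.val_castSucc]
        rw [if_neg (by omega), if_neg (by omega), if_pos trivial]
        simp only [zero_add, mul_one]
        congr 2
        refine Matrix.ext fun a b => ?_
        rw [Matrix.submatrix_apply, Matrix.updateRow_ne (Fin.castSucc_lt_last a).ne,
          skipMatrix_apply, skipMatrix_apply]
        rfl
      · intro i
        have := i.2
        rw [Matrix.updateRow_self, skipMatrix_apply_of_eq rfl (skip_of_lt (by simp; omega))]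
        simp only [Fin.val_last, Fin.val_castSucc]
        rw [if_neg (by omega), if_neg (by omega), if_neg (by omega)]
        simp
    · rw [det_eq_of_last_col]
      · rw [Matrix.updateRow_self, skipMatrix_apply_of_eq rfl (skip_of_le (by simp; omega))]
        simp only [Fin.val_last, Fin.val_castSucc]
        rw [if_pos trivial, if_neg (by omega), if_neg (by omega)]
        simp only [add_zero, mul_zero]
        congr 2
        refine Matrix.ext fun a b => ?_
        rw [Matrix.submatrix_apply, Matrix.updateRow_ne (Fin.castSucc_lt_last a).ne,
          skipMatrix_apply, skipMatrix_apply]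
        rfl
      · intro i
        rw [Matrix.updateRow_ne (Fin.castSucc_lt_last i).ne, skipMatrix_castSucc_last (by omega)]
  rw [skipSum_succ hq ht hr, Fin.sum_univ_castSucc, hlast]
  congr 1
  have h0 : ∀ j : Fin n, diffRow q t ((j.castSucc : ℕ) + 1) ((n + 1 + 2 : ℕ) : ℤ) = 0 := fun j => by
    have := j.2
    rw [Fin.val_castSucc, diffRow_of_lt hq ht (by omega) (by omega), if_neg (by omega)]
  simp only [h0, map_zero, zero_mul, sum_const_zero, zero_add, Fin.val_last]
  rw [diffRow_of_lt hq ht (by omega) (by omega), if_pos (by omega)]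

/-- The determinant sum for the columns `1, ..., n + 1` without `r + 1`, where
`n = r + 1 + d`. -/
theorem skipSum_gap (hq : q ≠ 0) (ht : t ≠ 0) (r d : ℕ) :
    ∃ c c' : F, skipSum q t (r + 1 + d) (r + 1) =
      X ^ (d + 1) * skipSum q t r (r + 1) + Polynomial.C c * (X ^ (d + 1) * pathPoly F r) +
        if d = 0 then 0 else Polynomial.C c' * (X ^ (d - 1) * pathPoly F (r + 1)) := by
  induction d with
  | zero =>
    rcases r with _ | r
    · refine ⟨0, 0, ?_⟩
      rw [add_zero, skipSum_succ hq ht le_rfl]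
      simp
    · refine ⟨-topCoeff q t (r + 1), 0, ?_⟩
      rw [add_zero, skipSum_succ_succ hq ht le_rfl, if_pos rfl, det_skipMatrix_of_lt (by omega),
        if_pos rfl, map_neg]
      ring
  | succ d ih =>
    obtain ⟨c, c', h⟩ := ih
    have h1 := skipSum_succ_succ hq ht (n := r + d) (r := r + 1) (by omega)
    rw [if_neg (by omega), det_skipMatrix_add, show r + d + 2 = r + 1 + (d + 1) by ring,
      show r + d + 1 = r + 1 + d by ring, h] at h1
    rw [h1]
    -- The term with `c'` appears at `d = 1`; afterwards each further column multiplies it by `X`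
    -- and adds a multiple of the same polynomial.
    rcases d with _ | d
    · refine ⟨c, -topCoeff q t (r + 1 + 0), ?_⟩
      simp
      ring
    · refine ⟨c, c' - topCoeff q t (r + 1 + (d + 1)), ?_⟩
      rw [if_neg (by omega), if_neg (by omega), map_sub, Nat.add_sub_cancel, Nat.add_sub_cancel]
      ring

/-- Column `n + 3` is out of reach for all path rows, and among the exceptional rows only the last
one attains it. -/
theorem detSum_of_last_eq (hq : q ≠ 0) (ht : t ≠ 0) {n : ℕ} {y : Fin (n + 1) → ℤ}
    (hy : y (Fin.last n) = (n + 3 : ℕ)) :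
    detSum q t y = Polynomial.C (topCoeff q t (n + 1)) *
      (pathMatrix F fun b : Fin n => y b.castSucc).det := by
  have hz : ∀ a : Fin (n + 1), pathMatrix F y a (Fin.last n) = 0 := fun a => by
    have := a.2
    rw [pathMatrix, Matrix.of_apply, hy, pathRow_eq_zero (by push_cast; omega)]
  rw [detSum, Fin.sum_univ_castSucc, sum_eq_zero, zero_add, det_eq_of_last_col]
  · rw [Matrix.updateRow_self, hy, Fin.val_last, diffRow_of_lt hq ht (by omega) (by omega), if_pos rfl]
    congr 2
    refine Matrix.ext fun a b => ?_
    rw [Matrix.submatrix_apply, Matrix.updateRow_ne (Fin.castSucc_lt_last a).ne]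
    rfl
  · intro i
    rw [Matrix.updateRow_ne (Fin.castSucc_lt_last i).ne, hz]
  · intro j _
    refine Matrix.det_eq_zero_of_column_eq_zero (Fin.last n) fun i => ?_
    rw [Matrix.updateRow_apply]
    split_ifs
    · have := j.2
      rw [hy, Fin.val_castSucc, diffRow_of_lt hq ht (by omega) (by omega), if_neg (by omega), map_zero]
    · exact hz i

theorem detSum_of_lt_last {n : ℕ} {y : Fin (n + 1) → ℤ}
    (hy : ((n + 3 : ℕ) : ℤ) < y (Fin.last n)) : detSum q t y = 0 := by
  refine sum_eq_zero fun j _ => Matrix.det_eq_zero_of_column_eq_zero (Fin.last n) fun i => ?_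
  have := i.2
  have := j.2
  rw [Matrix.updateRow_apply]
  split_ifs
  · rw [diffRow_eq_zero (by push_cast at hy ⊢; omega), map_zero]
  · rw [pathMatrix, Matrix.of_apply, pathRow_eq_zero (by push_cast at hy ⊢; omega)]

theorem det_pathMatrix_of_lt_last {n : ℕ} {y : Fin (n + 1) → ℤ}
    (hy : ((n + 2 : ℕ) : ℤ) < y (Fin.last n)) : (pathMatrix F y).det = 0 := by
  refine Matrix.det_eq_zero_of_column_eq_zero (Fin.last n) fun i => ?_
  have := i.2
  rw [pathMatrix, Matrix.of_apply, pathRow_eq_zero (by push_cast at hy ⊢; omega)]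

end Gap

/-! ### The linear functional combining the recurrences -/

section Functional

variable {F : Type} [Field F] {q t : F}

/-- The functional `p ↦ ∑_{i ≤ k} B_i p_{2i}` on polynomials. -/
noncomputable def evenFunctional (B : ℕ → F) (k : ℕ) : F[X] →ₗ[F] F :=
  ∑ i ∈ range (k + 1), B i • Polynomial.lcoeff F (2 * i)

theorem evenFunctional_apply (B : ℕ → F) (k : ℕ) (p : F[X]) :
    evenFunctional B k p = ∑ i ∈ range (k + 1), B i * p.coeff (2 * i) := by
  simp [evenFunctional]

theorem evenFunctional_C_mul (B : ℕ → F) (k : ℕ) (c : F) (p : F[X]) :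
    evenFunctional B k (Polynomial.C c * p) = c * evenFunctional B k p := by
  rw [← smul_eq_C_mul, map_smul, smul_eq_mul]

theorem evenFunctional_odd (B : ℕ → F) (k i p : ℕ) :
    evenFunctional B k (X ^ (2 * i + 1) * pathPoly F p) = 0 := by
  rw [evenFunctional_apply]
  refine sum_eq_zero fun s _ => ?_
  rw [coeff_X_pow_mul']
  split_ifs with h
  · rw [show 2 * s - (2 * i + 1) = 2 * (s - i - 1) + 1 by omega, coeff_pathPoly_odd, mul_zero]
  · rw [mul_zero]

/-- The coefficients of `X ^ (2 * h) * pathPoly F (n - 2 * h)` are row `h` of the system for `B`.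
For `h > k` the lowest exponent is already beyond `2 * k`. -/
theorem evenFunctional_even {n k : ℕ} (hn : 2 * k + 1 ≤ n) {B : ℕ → ℤ} (hk : B k = 1)
    (hB : ∀ h < k, ∑ i ∈ Icc h k,
      (-1 : ℤ) ^ (i - h) * ((n - i - h - 1).choose (i - h) : ℤ) * B i = 0)
    {h : ℕ} (hh : 2 * h + 1 ≤ n) :
    evenFunctional (fun i => (B i : F)) k (X ^ (2 * h) * pathPoly F (n - 2 * h)) =
      if h = k then 1 else 0 := by
  have h1 : ∀ i, h ≤ i → (B i : F) * (X ^ (2 * h) * pathPoly F (n - 2 * h)).coeff (2 * i) =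
      (((-1 : ℤ) ^ (i - h) * ((n - i - h - 1).choose (i - h) : ℤ) * B i : ℤ) : F) := fun i hi => by
    rw [coeff_X_pow_mul', if_pos (by omega), show 2 * i - 2 * h = 2 * (i - h) by omega,
      show n - 2 * h = n - 2 * h - 1 + 1 by omega, coeff_pathPoly_even,
      show n - 2 * h - 1 - (i - h) = n - i - h - 1 by omega]
    push_cast
    ring
  have h2 : evenFunctional (fun i => (B i : F)) k (X ^ (2 * h) * pathPoly F (n - 2 * h)) =
      ((∑ i ∈ Icc h k, (-1 : ℤ) ^ (i - h) * ((n - i - h - 1).choose (i - h) : ℤ) * B i : ℤ) : F) := by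
    rw [evenFunctional_apply, Int.cast_sum, ← sum_congr rfl fun i hi => h1 i (mem_Icc.1 hi).1]
    refine (sum_subset (fun i hi => ?_) fun i hi hi' => ?_).symm
    · have := mem_Icc.1 hi
      exact mem_range.2 (by omega)
    · have := mem_range.1 hi
      rw [coeff_X_pow_mul', if_neg (fun hle => hi' (mem_Icc.2 (by omega))), mul_zero]
  rw [h2]
  rcases lt_trichotomy h k with hlt | rfl | hlt
  · rw [hB h hlt, if_neg hlt.ne, Int.cast_zero]
  · rw [Icc_self, sum_singleton, hk, if_pos rfl]; simp
  · rw [Icc_eq_empty (by omega), sum_empty, if_neg hlt.ne', Int.cast_zero]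

variable {n k : ℕ} {L : F[X] →ₗ[F] F}

theorem map_stablePart_odd (ht : t ≠ 0)
    (hodd : ∀ i p, L (X ^ (2 * i + 1) * pathPoly F p) = 0) (N i : ℕ) :
    L (X ^ (2 * i + 1) * stablePart q t N) = 0 := by
  induction N using Nat.twoStepInduction generalizing i with
  | zero => rw [stablePart_zero, mul_zero, map_zero]
  | one => rw [stablePart_one ht, ← smul_eq_C_mul, mul_smul_comm, map_smul, hodd, smul_zero]
  | more N h _ =>
    rw [stablePart_add_two ht, mul_add, map_add, ← smul_eq_C_mul, mul_smul_comm, map_smul, hodd,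
      smul_zero, zero_add, ← mul_assoc, ← pow_add, show 2 * i + 1 + 2 = 2 * (i + 1) + 1 by ring, h]

/-- Unfolded, the argument of `L` is a combination of the `X^{2h} P_{n-2h}` with `h ≥ j`; only `h =
k` survives, and it occurs exactly if `j ≤ k`. -/
theorem map_stablePart_even (ht : t ≠ 0) (hn : 2 * k + 1 ≤ n)
    (heven : ∀ h, 2 * h + 1 ≤ n →
      L (X ^ (2 * h) * pathPoly F (n - 2 * h)) = if h = k then 1 else 0) (N j : ℕ)
    (hj : n = 2 * j + N) :
    L (X ^ (2 * j) * stablePart q t N) = if j ≤ k then stableCoeff q t (n - 2 * k) else 0 := by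
  induction N using Nat.twoStepInduction generalizing j with
  | zero => rw [stablePart_zero, mul_zero, map_zero, if_neg (by omega)]
  | one =>
    have h1 := heven j (by omega)
    rw [show n - 2 * j = 1 by omega] at h1
    rw [stablePart_one ht, ← smul_eq_C_mul, mul_smul_comm, map_smul, h1]
    rcases eq_or_ne j k with rfl | hne
    · rw [if_pos rfl, if_pos le_rfl, show n - 2 * j = 1 by omega, smul_eq_mul, mul_one]
    · rw [if_neg hne, if_neg (by omega), smul_zero]
  | more N h _ =>
    have h1 := heven j (by omega)
    rw [show n - 2 * j = N + 2 by omega] at h1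
    rw [stablePart_add_two ht, mul_add, map_add, ← smul_eq_C_mul, mul_smul_comm, map_smul, h1,
      ← mul_assoc, ← pow_add, show 2 * j + 2 = 2 * (j + 1) by ring, h (j + 1) (by omega)]
    rcases eq_or_ne j k with rfl | hne
    · rw [if_pos rfl, if_neg (by omega), if_pos le_rfl, show n - 2 * j = N + 2 by omega,
        smul_eq_mul, mul_one, add_zero]
    · rw [if_neg hne, smul_zero, zero_add]
      simp only [show j + 1 ≤ k ↔ j ≤ k by omega]

theorem map_skipSum_odd (hq : q ≠ 0) (ht : t ≠ 0)
    (hodd : ∀ i p, L (X ^ (2 * i + 1) * pathPoly F p) = 0) {N r : ℕ} (hr : N < r) (i : ℕ) :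
    L (X ^ (2 * i + 1) * skipSum q t N r) = 0 := by
  rcases N with _ | _ | N
  · rw [skipSum_zero, mul_zero, map_zero]
  · obtain ⟨c, hc⟩ := skipSum_one hq ht hr
    rw [zero_add, hc, ← smul_eq_C_mul, mul_smul_comm, map_smul, hodd, smul_zero]
  · obtain ⟨c, hc⟩ := skipSum_add_two_eq hq ht hr
    rw [hc, mul_add, map_add, ← smul_eq_C_mul, mul_smul_comm, map_smul, hodd, smul_zero, zero_add,
      ← mul_assoc, ← pow_add, show 2 * i + 1 + 2 = 2 * (i + 1) + 1 by ring,
      map_stablePart_odd ht hodd]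

/-- The undetermined constant sits at `h = j`, which is why `j = k` is excluded. -/
theorem map_skipSum_even (hq : q ≠ 0) (ht : t ≠ 0) (hn : 2 * k + 1 ≤ n)
    (heven : ∀ h, 2 * h + 1 ≤ n →
      L (X ^ (2 * h) * pathPoly F (n - 2 * h)) = if h = k then 1 else 0) {N r j : ℕ} (hr : N < r)
    (hj : n = 2 * j + N) (hjk : j ≠ k) :
    L (X ^ (2 * j) * skipSum q t N r) = if j < k then stableCoeff q t (n - 2 * k) else 0 := by
  rcases N with _ | _ | N
  · rw [skipSum_zero, mul_zero, map_zero, if_neg (by omega)]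
  · obtain ⟨c, hc⟩ := skipSum_one hq ht hr
    have h1 := heven j (by omega)
    rw [show n - 2 * j = 1 by omega, if_neg hjk] at h1
    rw [zero_add, hc, ← smul_eq_C_mul, mul_smul_comm, map_smul, h1, smul_zero, if_neg (by omega)]
  · obtain ⟨c, hc⟩ := skipSum_add_two_eq hq ht hr
    have h1 := heven j (by omega)
    rw [show n - 2 * j = N + 2 by omega, if_neg hjk] at h1
    rw [hc, mul_add, map_add, ← smul_eq_C_mul, mul_smul_comm, map_smul, h1, smul_zero, zero_add,
      ← mul_assoc, ← pow_add, show 2 * j + 2 = 2 * (j + 1) by ring,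
      map_stablePart_even ht hn heven N (j + 1) (by omega)]
    rfl

/-- The combined recurrences at the weight `ω_p`, `p` odd. -/
theorem map_skipSum_gap_odd (hq : q ≠ 0) (ht : t ≠ 0)
    (hodd : ∀ i p, L (X ^ (2 * i + 1) * pathPoly F p) = 0) {j : ℕ} (hj : 2 * j + 1 ≤ n) :
    L (skipSum q t n (n + 1 - (2 * j + 1))) = 0 := by
  obtain ⟨r, rfl⟩ : ∃ r, n = r + 1 + 2 * j := ⟨n - (2 * j + 1), by omega⟩
  obtain ⟨c, c', h⟩ := skipSum_gap hq ht r (2 * j)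
  rw [show r + 1 + 2 * j + 1 - (2 * j + 1) = r + 1 by omega, h, map_add, map_add,
    map_skipSum_odd hq ht hodd (Nat.lt_succ_self r), ← smul_eq_C_mul, map_smul, hodd]
  rcases j with _ | j
  · simp
  · rw [if_neg (by omega), ← smul_eq_C_mul, map_smul,
      show 2 * (j + 1) - 1 = 2 * j + 1 by omega, hodd]
    simp

/-- The combined recurrences at the weight `ω_{2j}`. -/
theorem map_skipSum_gap_even (hq : q ≠ 0) (ht : t ≠ 0) (hn : 2 * k + 1 ≤ n)
    (heven : ∀ h, 2 * h + 1 ≤ n →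
      L (X ^ (2 * h) * pathPoly F (n - 2 * h)) = if h = k then 1 else 0) {j : ℕ}
    (hj : 2 * j ≤ n) (hjk : j ≠ k) (hjk' : j ≠ k + 1) :
    L (skipSum q t n (n + 1 - 2 * j)) = if j < k then stableCoeff q t (n - 2 * k) else 0 := by
  rcases j with _ | j
  · rw [← map_skipSum_even hq ht hn heven (show n < n + 1 - 2 * 0 by omega) (by omega) hjk, mul_zero,
      pow_zero, one_mul]
  obtain ⟨r, rfl⟩ : ∃ r, n = r + 1 + (2 * j + 1) := ⟨n - (2 * j + 2), by omega⟩
  obtain ⟨c, c', h⟩ := skipSum_gap hq ht r (2 * j + 1)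
  have h1 : L (X ^ (2 * j) * pathPoly F (r + 2)) = 0 := by
    have := heven j (by omega)
    rwa [if_neg (by omega), show r + 1 + (2 * j + 1) - 2 * j = r + 2 by omega] at this
  have h2 : L (X ^ (2 * j + 2) * pathPoly F r) = 0 := by
    rcases r with _ | r
    · simp
    · have := heven (j + 1) (by omega)
      rwa [if_neg (by omega), show r + 1 + 1 + (2 * j + 1) - 2 * (j + 1) = r + 1 by omega,
        mul_add] at this
  -- This index does not match `n - 2h`; the recursion splits the term into those with `h = j` and
  -- `h = j + 1`. Both exclusions on the weight are needed to kill them.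
  have h3 : L (X ^ (2 * j) * pathPoly F (r + 1)) = 0 := by
    have e : X ^ (2 * j) * pathPoly F (r + 1) =
        X ^ (2 * j) * pathPoly F (r + 2) + X ^ (2 * j + 2) * pathPoly F r := by
      rw [pathPoly_add_two]; ring
    rw [e, map_add, h1, h2, add_zero]
  rw [if_neg (by omega)] at h
  rw [show r + 1 + (2 * j + 1) + 1 - 2 * (j + 1) = r + 1 by omega, h, map_add, map_add,
    show 2 * j + 1 + 1 = 2 * (j + 1) by ring,
    map_skipSum_even hq ht hn heven (Nat.lt_succ_self r) (by omega) hjk, ← smul_eq_C_mul, map_smul,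
    ← smul_eq_C_mul, map_smul, Nat.add_sub_cancel, h3,
    show 2 * (j + 1) = 2 * j + 2 by ring, h2]
  simp

end Functional

/-! ### Dominant weights -/

section Dominant

variable {n : ℕ}

theorem IsDominant.antitone {v : Weight n} (h : IsDominant v) : Antitone v := by
  intro i j hij
  rcases hij.eq_or_lt with rfl | hij
  · exact le_rfl
  · have := h _ (posRoots_pair i j hij).1
    rw [dotProduct_sub, dotProduct_e, dotProduct_e] at this
    omega

theorem IsDominant.nonneg {v : Weight n} (h : IsDominant v) (i : Fin n) : 0 ≤ v i := by
  have := h _ (posRoots_long i)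
  rw [dotProduct_smul, dotProduct_e, smul_eq_mul] at this
  omega

theorem isDominant_of_antitone {v : Weight n} (h : Antitone v) (h0 : ∀ i, 0 ≤ v i) :
    IsDominant v := by
  intro α hα
  simp only [posRoots, mem_union, mem_image, mem_filter, mem_univ, true_and, Prod.exists] at hα
  rcases hα with (⟨i, j, hij, rfl⟩ | ⟨i, j, hij, rfl⟩) | ⟨i, rfl⟩
  · rw [dotProduct_sub, dotProduct_e, dotProduct_e]
    have := h hij.le
    omega
  · rw [dotProduct_add, dotProduct_e, dotProduct_e]
    have := h0 i
    have := h0 j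
    omega
  · rw [dotProduct_smul, dotProduct_e, smul_eq_mul]
    have := h0 i
    omega

theorem omega_antitone (m : ℕ) : Antitone (omega n m) := by
  intro i j hij
  have : (i : ℕ) ≤ j := hij
  simp only [omega]
  split_ifs <;> omega

theorem omega_nonneg (m : ℕ) (i : Fin n) : 0 ≤ omega n m i := by
  simp only [omega]
  split_ifs <;> omega

theorem isDominant_omega (m : ℕ) : IsDominant (omega n m) :=
  isDominant_of_antitone (omega_antitone m) (omega_nonneg m)

theorem isDominant_omega_add (m p : ℕ) : IsDominant (omega n m + omega n p) :=
  isDominant_of_antitone (fun _ _ hij => add_le_add (omega_antitone m hij) (omega_antitone p hij))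
    fun i => add_nonneg (omega_nonneg m i) (omega_nonneg p i)

theorem omega_inj {m p : ℕ} (hm : m ≤ n) (hp : p ≤ n) (h : omega n m = omega n p) : m = p := by
  wlog hlt : m < p generalizing m p
  · by_contra hne
    exact hne (this hp hm h.symm (by omega)).symm
  have := congrFun h ⟨m, by omega⟩
  simp [omega, hlt] at this

theorem exists_threshold {v : Weight n} (h : Antitone v) :
    ∃ p ≤ n, ∀ a : Fin n, (a : ℕ) < p ↔ 0 < v a := by
  classical
  have hex : ∃ p, ∀ a : Fin n, p ≤ (a : ℕ) → v a ≤ 0 := ⟨n, fun a ha => by omega⟩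
  refine ⟨Nat.find hex, Nat.find_min' hex fun a ha => by omega, fun a => ⟨fun ha => ?_, fun ha => ?_⟩⟩
  · have := Nat.find_min hex ha
    push Not at this
    obtain ⟨b, hb, hb'⟩ := this
    exact hb'.trans_le (h hb)
  · by_contra hle
    have := Nat.find_spec hex a (not_lt.1 hle)
    omega

/-- The dominant weights, according to their first two coordinates. -/
theorem IsDominant.cases {v : Weight (n + 1)} (h : IsDominant v) :
    (∃ p ≤ n + 1, v = omega (n + 1) p) ∨ (∃ p ≤ n, v = omega (n + 1) 1 + omega (n + 1) (p + 1)) ∨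
      3 ≤ v 0 ∨ (v 0 = 2 ∧ ∃ hn : 0 < n, 2 ≤ v ⟨1, by omega⟩) := by
  obtain ⟨p, hp, hv⟩ := exists_threshold h.antitone
  have hle : ∀ a, v a ≤ v 0 := fun a => h.antitone (Fin.zero_le a)
  rcases lt_or_ge (v 0) 2 with h0 | h0
  · refine Or.inl ⟨p, hp, ?_⟩
    ext a
    have h1 := hv a
    have h2 := hle a
    have h3 := h.nonneg a
    simp only [omega]
    split_ifs with h4
    · have := h1.1 h4; omega
    · have : ¬ 0 < v a := fun h5 => h4 (h1.2 h5)
      omega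
  rcases lt_or_ge 2 (v 0) with h0' | h0'
  · exact Or.inr (Or.inr (Or.inl h0'))
  have hv0 : v 0 = 2 := le_antisymm h0' h0
  by_cases h2 : ∃ hn : 0 < n, 2 ≤ v ⟨1, by omega⟩
  · exact Or.inr (Or.inr (Or.inr ⟨hv0, h2⟩))
  have hp0 : 0 < p := (hv 0).2 (by omega)
  refine Or.inr (Or.inl ⟨p - 1, by omega, ?_⟩)
  rw [Nat.sub_add_cancel hp0]
  ext a
  have h1 := hv a
  have h3 := h.nonneg a
  simp only [omega, Pi.add_apply]
  by_cases ha : (a : ℕ) = 0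
  · obtain rfl : a = 0 := Fin.ext ha
    rw [if_pos (by simp), if_pos (by simpa using hp0), hv0]
    rfl
  · have ha2 := a.2
    have h4 : v a < 2 := by
      by_contra h5
      have h6 : v a ≤ v ⟨1, by omega⟩ := h.antitone (Nat.one_le_iff_ne_zero.2 ha)
      exact h2 ⟨by omega, by omega⟩
    rw [if_neg (by omega)]
    split_ifs with h5
    · have := h1.1 h5; omega
    · have : ¬ 0 < v a := fun h6 => h5 (h1.2 h6)
      omega

end Dominant

/-! ### The combined recurrences -/

section Combination

variable {n k : ℕ}

theorem q_ne_zero : q ≠ 0 := by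
  rw [q, Ne, FaithfulSMul.algebraMap_eq_zero_iff]
  exact MvPolynomial.X_ne_zero 0

theorem t_ne_zero : t ≠ 0 := by
  rw [t, Ne, FaithfulSMul.algebraMap_eq_zero_iff]
  exact MvPolynomial.X_ne_zero 1

theorem t_ne_one : t ≠ 1 := by
  rw [t, ← map_one (algebraMap (MvPolynomial (Fin 2) ℂ) RatQT)]
  intro h
  have h1 := FaithfulSMul.algebraMap_injective (MvPolynomial (Fin 2) ℂ) RatQT h
  have h2 := congrArg (MvPolynomial.eval fun _ => (0 : ℂ)) h1
  simp at h2

theorem R_apply_of_not_isDominant {ν : Weight n} (h : ¬ IsDominant ν) : R n k ν = 0 := by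
  rw [R, recurrence, Finsupp.finsetSum_apply]
  refine sum_eq_zero fun p _ => ?_
  rw [Finsupp.finsetSum_apply]
  refine sum_eq_zero fun i _ => ?_
  rw [Finsupp.smul_apply, C_apply_of_not_isDominant _ _ h, smul_zero]

/-- The columns of the determinant for the weight `ω_p`. -/
theorem omega_add_rho_rev {p : ℕ} (b : Fin n) :
    (omega n p + rho n) b.rev = (skip (n + 1 - p) b : ℤ) := by
  have := b.2
  simp only [Pi.add_apply, omega, rho, Fin.val_rev, skip]
  split_ifs <;> omega

theorem sum_R_apply (B : ℕ → RatQT) (hn : 2 * k + 1 ≤ n) {ν : Weight n} (hν : IsDominant ν) :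
    (∑ i ∈ range (k + 1), B i • R n i) ν =
      evenFunctional B k (detSum q t fun b => (ν + rho n) b.rev) := by
  rw [evenFunctional_apply, Finsupp.finsetSum_apply]
  refine sum_congr rfl fun i hi => ?_
  have := mem_range.1 hi
  rw [Finsupp.smul_apply, R_apply_eq_coeff (by omega) hν, smul_eq_mul]

theorem detSum_omega (p : ℕ) :
    (detSum q t fun b => (omega n p + rho n) b.rev) = skipSum q t n (n + 1 - p) := by
  simp only [omega_add_rho_rev]
  rfl

/-- The determinant sum for the weight `ω_1 + ω_{p+1}`. -/
theorem detSum_omega_add {p : ℕ} (hp : p ≤ n) :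
    (detSum q t fun b => (omega (n + 1) 1 + omega (n + 1) (p + 1) + rho (n + 1)) b.rev) =
      Polynomial.C (topCoeff q t (n + 1)) * (X ^ p * pathPoly RatQT (n + 1 - p)) := by
  rw [detSum_of_last_eq q_ne_zero t_ne_zero]
  · obtain ⟨r, rfl⟩ : ∃ r, n = r + p := ⟨n - p, by omega⟩
    rw [show r + p + 1 - p = r + 1 by omega, ← det_skipMatrix_add, skipMatrix]
    congr 3
    ext b
    have := b.2
    have h1 : r + p - (b : ℕ) ≠ 0 := by omega
    simp only [Pi.add_apply, omega, rho, Fin.val_rev, Fin.val_castSucc, skip]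
    split_ifs <;> omega
  · rw [Fin.rev_last]
    simp [omega, rho]
    ring

theorem detSum_of_three_le {ν : Weight (n + 1)} (h : 3 ≤ ν 0) :
    (detSum q t fun b => (ν + rho (n + 1)) b.rev) = 0 := by
  refine detSum_of_lt_last ?_
  rw [Fin.rev_last]
  simp [rho]
  omega

/-- Once the column of the first coordinate has been expanded, that of the second lies beyond the
reach of the remaining path rows. -/
theorem detSum_of_two_two {ν : Weight (n + 1)} (h0 : ν 0 = 2) (hn : 0 < n)
    (h1 : 2 ≤ ν ⟨1, by omega⟩) : (detSum q t fun b => (ν + rho (n + 1)) b.rev) = 0 := by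
  obtain ⟨n, rfl⟩ : ∃ m, n = m + 1 := ⟨n - 1, by omega⟩
  have hr : (Fin.last n).castSucc.rev = (⟨1, by omega⟩ : Fin (n + 1 + 1)) := by
    ext
    simp [Fin.val_rev]
  rw [detSum_of_last_eq q_ne_zero t_ne_zero, det_pathMatrix_of_lt_last, mul_zero]
  · rw [hr]
    change _ < ν ⟨1, by omega⟩ + (((n + 1 + 1 : ℕ) : ℤ) - ((1 : ℕ) : ℤ))
    push_cast
    omega
  · rw [Fin.rev_last]
    simp [rho, h0]
    ring

theorem LambdaTwo_eq (hn : 2 * k + 1 ≤ n) : LambdaTwo n k = topCoeff q t n := by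
  obtain ⟨n, rfl⟩ : ∃ m, n = m + 1 := ⟨n - 1, by omega⟩
  rw [LambdaTwo, lam, R_apply_eq_coeff hn (isDominant_omega_add _ _), detSum_omega_add (by omega),
    coeff_C_mul, show n + 1 - 2 * k = n - 2 * k + 1 by omega]
  have := coeff_X_pow_mul (pathPoly RatQT (n - 2 * k + 1)) (2 * k) 0
  rw [zero_add, coeff_zero_pathPoly] at this
  rw [this, mul_one]

theorem lam_ne_omega {m : ℕ} (hn : 0 < n) : lam n k ≠ omega n m := fun h => by
  have := congrFun h ⟨0, hn⟩
  rw [lam_apply] at this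
  simp only [omega] at this
  split_ifs at this <;> omega

theorem Ctwo_eq : Ctwo n k = Finsupp.single (lam n k) 1 :=
  C_of_isDominant (isDominant_omega_add _ _)

theorem Cone_eq : Cone n k = Finsupp.single (omega n (2 * k)) 1 :=
  C_of_isDominant (isDominant_omega _)

/-- A linear form with prescribed values at the dominant weights `ω_p` and `ω_1 + ω_p`. -/
theorem linForm_eq (hn : 2 * k + 1 ≤ n) {S : LinForm n} {Λ Γ₀ : RatQT}
    (hodd : ∀ j, 2 * j + 1 ≤ n → S (omega n (2 * j + 1)) = 0)
    (heven : ∀ j, 2 * j ≤ n → j ≠ k → j ≠ k + 1 →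
      S (omega n (2 * j)) = if j < k then Γ₀ else 0)
    (hlam : ∀ p, p + 1 ≤ n → S (omega n 1 + omega n (p + 1)) = if p = 2 * k then Λ else 0)
    (hzero : ∀ ν, (∀ p, p ≤ n → ν ≠ omega n p) →
      (∀ p, p + 1 ≤ n → ν ≠ omega n 1 + omega n (p + 1)) → S ν = 0) :
    S = Λ • Ctwo n k + (if n = 2 * k + 1 then 0 else S (omega n (2 * (k + 1))) • Cone n (k + 1)) +
      S (omega n (2 * k)) • Cone n k + Γ₀ • ∑ j ∈ range k, Cone n j := by
  classical
  ext ν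
  simp only [Finsupp.add_apply, Finsupp.smul_apply, smul_eq_mul, Finsupp.finsetSum_apply]
  have hmid : (if n = 2 * k + 1 then 0 else S (omega n (2 * (k + 1))) • Cone n (k + 1)) ν =
      if n = 2 * k + 1 then 0 else S (omega n (2 * (k + 1))) *
        if omega n (2 * (k + 1)) = ν then 1 else 0 := by
    split_ifs with h1 <;> simp [Cone_eq, *]
  rw [hmid, Ctwo_eq, Finsupp.single_apply]
  simp only [Cone_eq, Finsupp.single_apply]
  by_cases h1 : ∃ p ≤ n, ν = omega n p
  · obtain ⟨p, hp, rfl⟩ := h1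
    have hinj : ∀ j, 2 * j ≤ n → (omega n (2 * j) = omega n p ↔ 2 * j = p) := fun j hj =>
      ⟨fun h => omega_inj hj hp h, fun h => by rw [h]⟩
    rw [if_neg (lam_ne_omega (by omega))]
    have hsum : ∑ j ∈ range k, (if omega n (2 * j) = omega n p then (1 : RatQT) else 0) =
        ∑ j ∈ range k, if 2 * j = p then 1 else 0 := sum_congr rfl fun j hj => by
      have := mem_range.1 hj
      simp only [hinj j (by omega)]
    simp only [hsum, hinj k (by omega)]
    -- If `n = 2 * k + 1`, then `2 * (k + 1)` exceeds `n` and no weight `ω_p` with `p ≤ n` has this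
    -- index.
    have hmid' : (if n = 2 * k + 1 then 0 else S (omega n (2 * (k + 1))) *
        if omega n (2 * (k + 1)) = omega n p then 1 else 0) =
          if 2 * (k + 1) = p then S (omega n p) else 0 := by
      by_cases hnk : n = 2 * k + 1
      · rw [if_pos hnk, if_neg (by omega)]
      · rw [if_neg hnk]
        simp only [hinj (k + 1) (by omega)]
        split_ifs with h <;> simp [h]
    rw [hmid']
    obtain ⟨j, rfl | rfl⟩ := Nat.even_or_odd' p
    · have hsum' : ∑ i ∈ range k, (if 2 * i = 2 * j then (1 : RatQT) else 0) =
          if j < k then 1 else 0 := by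
        simp only [mul_right_inj' (two_ne_zero' ℕ), sum_ite_eq', mem_range]
      rw [hsum']
      rcases eq_or_ne j k with rfl | hjk
      · simp
      · rcases eq_or_ne j (k + 1) with rfl | hjk'
        · simp
        · rw [heven j hp hjk hjk', if_neg (show ¬ 2 * (k + 1) = 2 * j by omega),
            if_neg (show ¬ 2 * k = 2 * j by omega)]
          simp
    · rw [hodd j hp, if_neg (by omega), if_neg (by omega), sum_eq_zero fun i _ => if_neg (by omega)]
      simp
  · push Not at h1
    have h2 : ∀ m, ν ≠ omega n m := fun m => by
      rcases le_or_gt m n with hm | hm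
      · exact h1 m hm
      · have : omega n m = omega n n := by
          ext a
          have := a.2
          simp only [omega]
          rw [if_pos (by omega), if_pos (by omega)]
        rw [this]
        exact h1 n le_rfl
    have h3 : ∀ m, (if omega n m = ν then (1 : RatQT) else 0) = 0 := fun m => if_neg (h2 m).symm
    simp only [h3, mul_zero, ite_self, sum_const_zero, add_zero]
    by_cases h3 : ∃ p, p + 1 ≤ n ∧ ν = omega n 1 + omega n (p + 1)
    · obtain ⟨p, hp, rfl⟩ := h3
      rw [hlam p hp]
      have : lam n k = omega n 1 + omega n (p + 1) ↔ p = 2 * k := by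
        rw [lam, add_right_inj]
        exact ⟨fun h => by have := omega_inj hn hp h; omega, fun h => by rw [h]⟩
      simp [this]
    · push Not at h3
      rw [hzero ν h1 h3, if_neg fun h => h3 (2 * k) hn h.symm, mul_zero]

/-- The combination of the recurrences with coefficients solving the triangular system. -/
theorem sum_R_eq (hn : 2 * k + 1 ≤ n) {B : ℕ → ℤ} (hk : B k = 1)
    (hB : ∀ h < k, ∑ i ∈ Icc h k,
      (-1 : ℤ) ^ (i - h) * ((n - i - h - 1).choose (i - h) : ℤ) * B i = 0) {S : LinForm n}
    (hS : S = ∑ i ∈ range (k + 1), (B i : RatQT) • R n i) :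
    S = LambdaTwo n k • Ctwo n k +
      (if n = 2 * k + 1 then 0 else S (omega n (2 * (k + 1))) • Cone n (k + 1)) +
      S (omega n (2 * k)) • Cone n k + stableCoeff q t (n - 2 * k) • ∑ j ∈ range k, Cone n j := by
  have hL := fun h (hh : 2 * h + 1 ≤ n) => evenFunctional_even (F := RatQT) hn hk hB hh
  have hLo := evenFunctional_odd (fun i => (B i : RatQT)) k
  have hval : ∀ ν, IsDominant ν → S ν = evenFunctional (fun i => (B i : RatQT)) k
      (detSum q t fun b => (ν + rho n) b.rev) := fun ν hν => by
    rw [hS]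
    exact sum_R_apply (fun i => (B i : RatQT)) hn hν
  obtain ⟨n, rfl⟩ : ∃ m, n = m + 1 := ⟨n - 1, by omega⟩
  refine linForm_eq hn (fun j hj => ?_) (fun j hj h1 h2 => ?_) (fun p hp => ?_) fun ν h1 h2 => ?_
  · rw [hval _ (isDominant_omega _), detSum_omega, map_skipSum_gap_odd q_ne_zero t_ne_zero hLo hj]
  · rw [hval _ (isDominant_omega _), detSum_omega,
      map_skipSum_gap_even q_ne_zero t_ne_zero hn hL hj h1 h2]
  · rw [hval _ (isDominant_omega_add _ _), detSum_omega_add (by omega), evenFunctional_C_mul,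
      LambdaTwo_eq hn]
    obtain ⟨j, rfl | rfl⟩ := Nat.even_or_odd' p
    · rw [hL j (by omega)]
      simp
    · rw [hLo, if_neg (by omega), mul_zero]
  · by_cases hν : IsDominant ν
    · rw [hval ν hν]
      rcases hν.cases with ⟨p, hp, h⟩ | ⟨p, hp, h⟩ | h | ⟨h, hn', h'⟩
      · exact absurd h (h1 p hp)
      · exact absurd h (h2 p (by omega))
      · rw [detSum_of_three_le h, map_zero]
      · rw [detSum_of_two_two h hn' h', map_zero]
    · rw [hS, Finsupp.finsetSum_apply]
      refine sum_eq_zero fun i _ => ?_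
      rw [Finsupp.smul_apply, R_apply_of_not_isDominant hν, smul_zero]

end Combination

end TypeC

theorem mainTheorem8 (n k : ℕ) (hn : 2 * k + 1 ≤ n) :
    ∃ (B : ℕ → ℤ) (Γ : ℕ → TypeC.RatQT),
      B k = 1 ∧
      (∀ h < k, ∑ i ∈ Finset.Icc h k,
        (-1 : ℤ) ^ (i - h) * ((n - i - h - 1).choose (i - h) : ℤ) * B i = 0) ∧
      (n = 2 * k + 1 →
        ∑ i ∈ Finset.range (k + 1), (B i : TypeC.RatQT) • TypeC.R n i =
          TypeC.LambdaTwo n k • TypeC.Ctwo n k + Γ k • TypeC.Cone n k +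
            Γ 0 • ∑ j ∈ Finset.range k, TypeC.Cone n j) ∧
      (n ≠ 2 * k + 1 →
        ∑ i ∈ Finset.range (k + 1), (B i : TypeC.RatQT) • TypeC.R n i =
          TypeC.LambdaTwo n k • TypeC.Ctwo n k + Γ (k + 1) • TypeC.Cone n (k + 1) +
            Γ k • TypeC.Cone n k + Γ 0 • ∑ j ∈ Finset.range k, TypeC.Cone n j) ∧
      (1 ≤ k → Γ 0 =
        (TypeC.t ^ 2 + TypeC.q) * (TypeC.t - TypeC.q) * (TypeC.t ^ (2 * (n - 2 * k)) - 1) /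
          (TypeC.t ^ (n - 2 * k + 1) * (TypeC.t - 1))) := by
  obtain ⟨B, hk, hB⟩ := TypeC.exists_triangular_solution
    (fun h i => (-1 : ℤ) ^ (i - h) * ((n - i - h - 1).choose (i - h) : ℤ)) (fun h => by simp) k
  generalize hS : ∑ i ∈ Finset.range (k + 1), (B i : TypeC.RatQT) • TypeC.R n i = S
  have key := TypeC.sum_R_eq hn hk hB hS.symm
  -- For `k = 0` the entry `Γ 0` is also `Γ k` and must be the actual coefficient of `C_0`; the sum
  -- multiplied by `Γ 0` is then empty.
  let Γ : ℕ → TypeC.RatQT := fun i => if 1 ≤ k ∧ i = 0 then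
    TypeC.stableCoeff TypeC.q TypeC.t (n - 2 * k) else S (TypeC.omega n (2 * i))
  have hΓk : Γ k = S (TypeC.omega n (2 * k)) := if_neg (by omega)
  have hΓk' : Γ (k + 1) = S (TypeC.omega n (2 * (k + 1))) := if_neg (by omega)
  have hΓ0 : 1 ≤ k → Γ 0 = TypeC.stableCoeff TypeC.q TypeC.t (n - 2 * k) := fun h =>
    if_pos ⟨h, rfl⟩
  have hsum : TypeC.stableCoeff TypeC.q TypeC.t (n - 2 * k) • ∑ j ∈ Finset.range k, TypeC.Cone n j =
      Γ 0 • ∑ j ∈ Finset.range k, TypeC.Cone n j := by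
    rcases Nat.eq_zero_or_pos k with h | h
    · simp [h]
    · rw [hΓ0 h]
  refine ⟨B, Γ, hk, hB, fun h => ?_, fun h => ?_, fun h => ?_⟩
  · rw [hS]
    rwa [if_pos h, add_zero, ← hΓk, hsum] at key
  · rw [hS]
    rwa [if_neg h, ← hΓk, ← hΓk', hsum] at key
  · rw [hΓ0 h, TypeC.stableCoeff_eq TypeC.t_ne_zero TypeC.t_ne_one]
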